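/- **Setting.** Let $P_{\mathcal X}$ be a probability distribution on a data space $\mathcal X$, let $p(a\mid x)$ be a jointly measurable conditional density on an augmented space $\mathcal A$ with respect to a $\sigma$-finite reference measure $da$, and let $P_{\mathcal A}$ have density $p(a)=\int p(a\mid x)\,dP_{\mathcal X}(x)$. Put $(\Gamma f)(a)=\int f(x)\frac{p(a\mid x)}{p(a)}\,dP_{\mathcal X}(x)$ and $(\Gamma^* g)(x)=\int g(a)p(a\mid x)\,da$, and let $\lambda_1\ge\lambda_2\ge\cdots\ge 0$ be the eigenvalues, with multiplicity, of $\Gamma^*\Gamma$ on $L^2(P_{\mathcal X})$. Let $\kappa^2$ be the $P_{\mathcal X}$-essential supremum of $K_X(x,x)=\int \frac{p(a\mid x)^2}{p(a)}\,da$, and assume $\kappa<\infty$. Let $N\ge 1$ and let $x_1,\dots,x_N$ be i.i.d. from $P_{\mathcal X}$. Let $\hat P_{\mathcal X}=\frac1N\sum_k\delta_{x_k}$, let $\hat P_{\mathcal A}$ have density $\hat p(a)=\frac1N\sum_k p(a\mid x_k)$, and let $(\bar\Gamma f)(a)=\frac1N\sum_k \frac{f(x_k)p(a\mid x_k)}{\hat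 p(a)}$ (with $0/0=0$). Let $\bar\lambda_1\ge\bar\lambda_2\ge\cdots\ge0$ be the eigenvalues, with multiplicity, of $\Gamma^*\bar\Gamma$ on $L^2(\hat P_{\mathcal X})$, continued by zeros beyond its dimension. Top-$d$ empirical eigenfunctions are functions $\bar\phi_1,\dots,\bar\phi_d$ on $\mathcal A$, orthonormal in $L^2(\hat P_{\mathcal A})$, with $\bar\Gamma\Gamma^*\bar\phi_i=\bar\lambda_i\bar\phi_i$, $\hat P_{\mathcal A}$- and $P_{\mathcal A}$-almost everywhere. For them let $$G_{ij}=\langle\bar\phi_i,\bar\phi_j\rangle_{L^2(P_{\mathcal A})},\quad F_{ij}=\langle\Gamma^*\bar\phi_i,\Gamma^*\bar\phi_j\rangle_{L^2(P_{\mathcal X})},\quad \hat G_{ij}=\langle\bar\phi_i,\bar\phi_j\rangle_{L^2(\hat P_{\mathcal A})},\quad \hat F_{ij}=\langle\Gamma^*\bar\phi_i,\Gamma^*\bar\phi_j\rangle_{L^2(\hat P_{\mathcal X})},$$ and let $\gamma_G=\lambda_{\max}(G)/\lambda_{\min}(G)$. **Statement.** Let $d\ge1$ with $\lambda_d>0$,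 and let $\delta>0$. Then there is an event of probability at least $1-\delta$ on which both of the following hold. 1. $$\sum_{j=1}^d\bar\lambda_j\ \ge\ \sum_{i=1}^d\lambda_i-\Big(2+\sqrt{2\log\tfrac2\delta}\Big)\frac{(\lambda_d^{-1}+1)\kappa^2}{\sqrt N}\,d .$$ 2. If $\bar\lambda_d>0$, then for every choice of top-$d$ empirical eigenfunctions one has $\bar\phi_i\in L^2(P_{\mathcal A})$ and $\Gamma^*\bar\phi_i\in L^2(P_{\mathcal X})$ for all $i\le d$, the matrices $G$ and $\hat G$ are invertible, and with $C=\kappa\,\bar\lambda_d^{-1}\gamma_G^{1/2}$ $$\big|\operatorname{Tr}(\hat G^{-1}\hat F)-\operatorname{Tr}(G^{-1}F)\big|\ \le\ \Big(2+\sqrt{2\log\tfrac2\delta}\Big)\frac{C\kappa+\kappa^2}{\sqrt N}\,d .$$ (For $\delta>2$, where the logarithm is negative, the square root is read as $0$; the statement is trivial for $\delta\ge1$.) -/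

import Mathlib

open MeasureTheory ProbabilityTheory
open scoped ENNReal NNReal

/-- A data distribution `PX` on the data space `𝒳`, together with a random augmentation: given `x`,
the augmentation has density `p x a = p(a|x)` with respect to a σ-finite reference measure
`ν = da` on the augmented space `𝒜`. -/
structure Augmentation (𝒳 𝒜 : Type*) [MeasurableSpace 𝒳] [MeasurableSpace 𝒜] where
  /-- the data distribution -/
  PX : Measure 𝒳
  isProb : IsProbabilityMeasure PX
  /-- the reference measure on the augmented space -/
  ν : Measure 𝒜
  sigmaFinite : SigmaFinite ν
  /-- the conditional density `p(a|x)` -/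
  p : 𝒳 → 𝒜 → ℝ≥0
  measurable_p : Measurable (fun z : 𝒳 × 𝒜 => p z.1 z.2)
  lintegral_p : ∀ x, ∫⁻ a, (p x a : ℝ≥0∞) ∂ν = 1

attribute [instance] Augmentation.isProb Augmentation.sigmaFinite

/-- The empirical measure `(1/N) ∑ₖ δ_{x k}`. -/
noncomputable def empMeasure {𝒳 : Type*} [MeasurableSpace 𝒳] {N : ℕ} (x : Fin N → 𝒳) :
    Measure 𝒳 :=
  (N : ℝ≥0∞)⁻¹ • ∑ k, Measure.dirac (x k)

/-- The Gram matrix `(⟨f i, f j⟩)_{i,j}` in `L²(μ)`. -/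
noncomputable def gramL2 {α : Type*} [MeasurableSpace α] {d : ℕ} (μ : Measure α)
    (f : Fin d → α → ℝ) : Matrix (Fin d) (Fin d) ℝ :=
  Matrix.of fun i j => ∫ z, f i z * f j z ∂μ

/-- `e` is an orthonormal family in `L²(μ)` of eigenfunctions of `T`, with eigenvalues `s`. -/
def IsEigenfamily {α : Type*} [MeasurableSpace α] {n : ℕ} (μ : Measure α)
    (T : (α → ℝ) → α → ℝ) (s : Fin n → ℝ) (e : Fin n → α → ℝ) : Prop :=
  (∀ i, MemLp (e i) 2 μ) ∧ gramL2 μ e = 1 ∧ ∀ i, T (e i) =ᵐ[μ] fun z => s i * e i z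

/-- The `n`-th largest eigenvalue, counted with multiplicity and indexed from `n = 0`, of an operator
`T` on `L²(μ)`: the largest `t` such that there are `n + 1` orthonormal eigenfunctions whose
eigenvalues are all at least `t`. For a compact positive operator this is the usual nonincreasing
enumeration; it is `0` when `n + 1` exceeds the dimension of `L²(μ)` (the supremum is then over the
empty set). -/
noncomputable def sortedEigenvalue {α : Type*} [MeasurableSpace α] (μ : Measure α)
    (T : (α → ℝ) → α → ℝ) (n : ℕ) : ℝ :=
  sSup {t : ℝ | ∃ (s : Fin (n + 1) → ℝ) (e : Fin (n + 1) → α → ℝ),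
    IsEigenfamily μ T s e ∧ ∀ i, t ≤ s i}

/-- The condition number `λ_max / λ_min` of a real symmetric positive definite matrix. -/
noncomputable def condNumber {d : ℕ} (G : Matrix (Fin d) (Fin d) ℝ) : ℝ :=
  sSup (spectrum ℝ G) / sInf (spectrum ℝ G)

namespace Augmentation

variable {𝒳 𝒜 : Type*} [MeasurableSpace 𝒳] [MeasurableSpace 𝒜]

/-- The marginal density `p(a) = ∫ p(a|x) dPX(x)` of the augmentation. -/
noncomputable def pA (M : Augmentation 𝒳 𝒜) (a : 𝒜) : ℝ≥0∞ :=
  ∫⁻ x, (M.p x a : ℝ≥0∞) ∂M.PX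

/-- The marginal distribution of the augmentation. -/
noncomputable def PA (M : Augmentation 𝒳 𝒜) : Measure 𝒜 :=
  M.ν.withDensity M.pA

/-- `(Γ f)(a) = E[f(X) | a] = ∫ f(x) p(a|x) / p(a) dPX(x)`. -/
noncomputable def Gam (M : Augmentation 𝒳 𝒜) (f : 𝒳 → ℝ) (a : 𝒜) : ℝ :=
  ∫ x, f x * ((M.p x a : ℝ) / (M.pA a).toReal) ∂M.PX

/-- `(Γ* g)(x) = E[g(A) | x] = ∫ g(a) p(a|x) da`. -/
noncomputable def GamStar (M : Augmentation 𝒳 𝒜) (g : 𝒜 → ℝ) (x : 𝒳) : ℝ :=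
  ∫ a, g a * (M.p x a : ℝ) ∂M.ν

/-- The kernel `K_X(x, x') = ∫ p(a|x) p(a|x') / p(a) da`. -/
noncomputable def KX (M : Augmentation 𝒳 𝒜) (x x' : 𝒳) : ℝ≥0∞ :=
  ∫⁻ a, (M.p x a : ℝ≥0∞) * (M.p x' a : ℝ≥0∞) / M.pA a ∂M.ν

/-- The squared augmentation complexity `κ²`, as an extended number: the essential supremum of
`K_X(x, x)`. -/
noncomputable def kappaSq (M : Augmentation 𝒳 𝒜) : ℝ≥0∞ :=
  essSup (fun x => M.KX x x) M.PX

/-- The augmentation complexity `κ` (when it is finite). -/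
noncomputable def kappa (M : Augmentation 𝒳 𝒜) : ℝ :=
  Real.sqrt M.kappaSq.toReal

/-- The eigenvalues `λ₀ ≥ λ₁ ≥ ⋯` of `Γ*Γ` on `L²(PX)` (indexed from `0`). -/
noncomputable def eig (M : Augmentation 𝒳 𝒜) (i : ℕ) : ℝ :=
  sortedEigenvalue M.PX (fun f => M.GamStar (M.Gam f)) i

/-! Empirical objects, for a sample `x : Fin N → 𝒳`. -/

/-- The empirical marginal density `(1/N) ∑ₖ p(a|x k)`. -/
noncomputable def empDensity (M : Augmentation 𝒳 𝒜) {N : ℕ} (x : Fin N → 𝒳) (a : 𝒜) : ℝ≥0 :=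
  (N : ℝ≥0)⁻¹ * ∑ k, M.p (x k) a

/-- The empirical marginal distribution of the augmentation. -/
noncomputable def empPA (M : Augmentation 𝒳 𝒜) {N : ℕ} (x : Fin N → 𝒳) : Measure 𝒜 :=
  M.ν.withDensity fun a => (M.empDensity x a : ℝ≥0∞)

/-- The empirical operator `Γ̄`; its value is `0` at the points where the empirical density vanishes
(all summands are then `0 / 0 = 0`). -/
noncomputable def empGam (M : Augmentation 𝒳 𝒜) {N : ℕ} (x : Fin N → 𝒳) (f : 𝒳 → ℝ) (a : 𝒜) : ℝ :=
  (N : ℝ)⁻¹ * ∑ k, f (x k) * (M.p (x k) a : ℝ) / (M.empDensity x a : ℝ)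

/-- The eigenvalues of `Γ*Γ̄` on `L²` of the empirical measure (indexed from `0`). -/
noncomputable def empEig (M : Augmentation 𝒳 𝒜) {N : ℕ} (x : Fin N → 𝒳) (i : ℕ) : ℝ :=
  sortedEigenvalue (empMeasure x) (fun f => M.GamStar (M.empGam x f)) i

/-- `φ` is a choice of the top-`d` empirical eigenfunctions `φ̄`: they are orthonormal in `L²` of the
empirical distribution `empPA`, and `φ i` is an eigenfunction of `Γ̄Γ*` for the `i`-th largest
eigenvalue. The eigenvalue equation is required almost everywhere also for the population
distribution `PA`, because `φ` is used as an element of `L²(PA)`: this fixes the values of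
`φ i` off the support of `empPA`. -/
def IsTopEmpEigenfunctions (M : Augmentation 𝒳 𝒜) {N d : ℕ} (x : Fin N → 𝒳)
    (φ : Fin d → 𝒜 → ℝ) : Prop :=
  IsEigenfamily (M.empPA x) (fun g => M.empGam x (M.GamStar g)) (fun i => M.empEig x i) φ ∧
    ∀ i, M.empGam x (M.GamStar (φ i)) =ᵐ[M.PA] fun a => M.empEig x i * φ i a

/-- `F(i,j) = ⟨Γ*φ i, Γ*φ j⟩` in `L²(PX)`. -/
noncomputable def F (M : Augmentation 𝒳 𝒜) {d : ℕ} (φ : Fin d → 𝒜 → ℝ) :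
    Matrix (Fin d) (Fin d) ℝ :=
  gramL2 M.PX fun i => M.GamStar (φ i)

/-- `G(i,j) = ⟨φ i, φ j⟩` in `L²(PA)`. -/
noncomputable def G (M : Augmentation 𝒳 𝒜) {d : ℕ} (φ : Fin d → 𝒜 → ℝ) :
    Matrix (Fin d) (Fin d) ℝ :=
  gramL2 M.PA φ

/-- The empirical version of `F`. -/
noncomputable def empF (M : Augmentation 𝒳 𝒜) {N d : ℕ} (x : Fin N → 𝒳) (φ : Fin d → 𝒜 → ℝ) :
    Matrix (Fin d) (Fin d) ℝ :=
  gramL2 (empMeasure x) fun i => M.GamStar (φ i)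

/-- The empirical version of `G`. -/
noncomputable def empG (M : Augmentation 𝒳 𝒜) {N d : ℕ} (x : Fin N → 𝒳) (φ : Fin d → 𝒜 → ℝ) :
    Matrix (Fin d) (Fin d) ℝ :=
  gramL2 (M.empPA x) φ

end Augmentation

/-! Write `k(x,a) = p(a|x)/p(a)`. For almost every `x`, `(Γ*u)(x)` is the inner product of `u` with
`k(x,·)` in `L²(PA)`, and `‖k(x,·)‖² = K_X(x,x) ≤ κ²`. So the empirical mean of `Γ*u` is the pairing
of `u` with the empirical mean of a bounded random element of a Hilbert space, and that of `(Γ*u)²`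
is the pairing of `u ⊗ u` with the empirical mean of `k ⊗ k`, of norm at most `κ²`. A second moment
bound and McDiarmid's inequality control both deviations uniformly in `u`, at rate `r = (1 + √(2
log(2/δ)))/√N`, on one event of probability at least `1 - δ` (`exists_goodSample_event`). The rest
is deterministic on this event.

Let `u` have norm `1` in `L²(PA)` and `|u| ≤ C`. In the empirical Rayleigh quotient `‖Γ*u‖²/‖u‖²`
the numerator is off by at most `κ²r`. The denominator, the empirical mean of `Γ*(u²)`, is off by at
most `κr‖u²‖ ≤ κrC`. The quotient is at most `1` by Jensen, so it is off by at most `r(Cκ + κ²)`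
(`GoodSample.abs_rayleigh_sub_le`). Sup bounds come from eigen-equations: `u = ΓΓ*w` or `u = Γ̄Γ*w`,
where `|Γ*w| ≤ κ‖w‖` by Cauchy–Schwarz and averaging keeps the bound.

Claim 1 tests the empirical operator on population eigenfunctions, rotated to be orthogonal for both
measures; Ky Fan's inequality bounds the sum of their empirical Rayleigh quotients by `∑ λ̄ⱼ`. Claim
2 diagonalizes `G` in an orthonormal basis, which leaves `Ĝ = 1` unchanged, so the difference of
traces is a sum of `d` differences of Rayleigh quotients. -/

/-! ### Bounded differences: sub-Gaussian tails on a product space. -/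

/-- A bounded measurable function of independent coordinates which changes by at most `c` when a
single coordinate changes is sub-Gaussian around its mean. -/
theorem hasSubgaussianMGF_pi_of_bounded_differences {α : Type*} [MeasurableSpace α]
    (μ : Measure α) [IsProbabilityMeasure μ] {c : ℝ≥0} {C : ℝ} :
    ∀ (n : ℕ) (f : (Fin n → α) → ℝ), Measurable f → (∀ x, |f x| ≤ C) →
      (∀ x i y, |f (Function.update x i y) - f x| ≤ c) →
      HasSubgaussianMGF (fun x => f x - ∫ y, f y ∂(Measure.pi fun _ : Fin n => μ))
        (n * (c / 2) ^ 2) (Measure.pi fun _ : Fin n => μ) := by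
  intro n
  induction n with
  | zero =>
    intro f hf _ _
    have h0 : (fun x => f x - ∫ y, f y ∂(Measure.pi fun _ : Fin 0 => μ)) = fun _ => 0 := by
      funext x
      have : f = fun _ => f x := by
        funext y; rw [Subsingleton.elim y x]
      rw [this]; simp
    rw [h0]
    simp
  | succ n ih =>
    intro f hf hC hd
    have hint : ∀ {m : ℕ} (g : (Fin m → α) → ℝ), Measurable g → (∀ x, |g x| ≤ C) →
        Integrable g (Measure.pi fun _ : Fin m => μ) := fun g hg hb =>
      Integrable.of_bound hg.aestronglyMeasurable C (Filter.Eventually.of_forall hb)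
    set E := ∫ y, f y ∂(Measure.pi fun _ : Fin (n + 1) => μ) with hE
    have hexpint : ∀ t : ℝ, Integrable (fun x => Real.exp (t * (f x - E)))
        (Measure.pi fun _ : Fin (n + 1) => μ) := by
      intro t
      refine Integrable.of_bound (by fun_prop) (Real.exp (|t| * (C + |E|)))
        (Filter.Eventually.of_forall fun x => ?_)
      rw [Real.norm_eq_abs, abs_of_pos (Real.exp_pos _)]
      apply Real.exp_le_exp.2
      calc t * (f x - E) ≤ |t * (f x - E)| := le_abs_self _
        _ = |t| * |f x - E| := abs_mul _ _
        _ ≤ |t| * (C + |E|) := by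
          gcongr
          exact (abs_sub _ _).trans (by linarith [hC x])
    refine ⟨hexpint, fun t => ?_⟩
    let e := MeasurableEquiv.piFinSuccAbove (fun _ : Fin (n + 1) => α) 0
    have he : MeasurePreserving e.symm (μ.prod (Measure.pi fun _ : Fin n => μ))
        (Measure.pi fun _ : Fin (n + 1) => μ) :=
      (measurePreserving_piFinSuccAbove (fun _ : Fin (n + 1) => μ) 0).symm
    let F : α → (Fin n → α) → ℝ := fun a y => f (e.symm (a, y))
    have hFm : Measurable (fun z : α × (Fin n → α) => F z.1 z.2) := hf.comp e.symm.measurable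
    have hFm' : ∀ a, Measurable (F a) := fun a => hFm.comp measurable_prodMk_left
    have hes : ∀ a y, e.symm (a, y) = Fin.cons a y := by
      intro a y
      simp [e, MeasurableEquiv.piFinSuccAbove]
      rfl
    -- `g a` is the mean of `f` given that coordinate `0` is `a`; then `f - E` splits as `(F a - g
    -- a) + (g a - E)`.
    let g : α → ℝ := fun a => ∫ y, F a y ∂(Measure.pi fun _ : Fin n => μ)
    have hgm : Measurable g := (hFm.stronglyMeasurable.integral_prod_right).measurable
    have hEg : E = ∫ a, g a ∂μ := by
      rw [hE, ← he.integral_comp' (f := e.symm) f, integral_prod]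
      exact (he.integrable_comp_emb e.symm.measurableEmbedding).2 (hint f hf hC)
    have hg : ∀ a b, |g a - g b| ≤ c := by
      intro a b
      have h1 : g a - g b = ∫ y, (F a y - F b y) ∂(Measure.pi fun _ : Fin n => μ) :=
        (integral_sub (hint _ (hFm' a) fun y => hC _) (hint _ (hFm' b) fun y => hC _)).symm
      rw [h1]
      have := norm_integral_le_of_norm_le_const (μ := Measure.pi fun _ : Fin n => μ)
        (f := fun y => F a y - F b y) (C := c) (Filter.Eventually.of_forall fun y => by
          have := hd (Fin.cons b y) 0 a
          rw [Fin.update_cons_zero] at this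
          simpa only [F, hes, Real.norm_eq_abs] using this)
      simpa using this
    -- `g` takes values in an interval of length `c`, so Hoeffding's lemma gives the parameter
    -- `(c/2)²`.
    have hgsub : HasSubgaussianMGF (fun a => g a - ∫ b, g b ∂μ) ((c / 2) ^ 2) μ := by
      have : Nonempty α := ⟨(nonempty_of_isProbabilityMeasure μ).some⟩
      have hbdd : BddBelow (Set.range g) := by
        refine ⟨g Classical.ofNonempty - c, ?_⟩
        rintro _ ⟨a, rfl⟩
        have := abs_le.1 (hg Classical.ofNonempty a)
        linarith [this.2]
      have := hasSubgaussianMGF_of_mem_Icc (μ := μ) (X := g) (a := ⨅ a, g a)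
        (b := (⨅ a, g a) + c) hgm.aemeasurable (Filter.Eventually.of_forall fun a =>
          ⟨ciInf_le hbdd a, by
            have : g a - c ≤ ⨅ b, g b := le_ciInf fun b => by
              linarith [(abs_le.1 (hg a b)).2]
            linarith⟩)
      simpa using this
    have hmgf : mgf (fun x => f x - E) (Measure.pi fun _ : Fin (n + 1) => μ) t
        = ∫ a, Real.exp (t * (g a - E)) *
            ∫ y, Real.exp (t * (F a y - g a)) ∂(Measure.pi fun _ : Fin n => μ) ∂μ := by
      rw [mgf, ← he.integral_comp' (f := e.symm) (fun x => Real.exp (t * (f x - E))),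
        integral_prod]
      · refine integral_congr_ae (Filter.Eventually.of_forall fun a => ?_)
        simp only
        rw [← integral_const_mul]
        refine integral_congr_ae (Filter.Eventually.of_forall fun y => ?_)
        simp only [F]
        rw [← Real.exp_add]
        congr 1; ring
      · exact (he.integrable_comp_emb e.symm.measurableEmbedding).2 (hexpint t)
    rw [hmgf]
    -- The inductive bound for the slice `F a` is uniform in `a`, so it comes out of the outer
    -- integral and the parameters add.
    have hin : ∀ a, ∫ y, Real.exp (t * (F a y - g a)) ∂(Measure.pi fun _ : Fin n => μ)
        ≤ Real.exp ((n * (c / 2) ^ 2 : ℝ≥0) * t ^ 2 / 2) := by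
      intro a
      refine (ih (F a) (hFm' a) (fun y => hC _) (fun y i z => ?_)).mgf_le t
      have := hd (Fin.cons a y) i.succ z
      rw [← Fin.cons_update] at this
      simpa only [F, hes] using this
    have hge : Integrable (fun a => Real.exp (t * (g a - E))) μ := by
      rw [hEg]; exact hgsub.integrable_exp_mul t
    calc _ ≤ ∫ a, Real.exp (t * (g a - E)) *
            Real.exp ((n * (c / 2) ^ 2 : ℝ≥0) * t ^ 2 / 2) ∂μ := by
          refine integral_mono_of_nonneg (Filter.Eventually.of_forall fun a => ?_)
            (hge.mul_const _) (Filter.Eventually.of_forall fun a => ?_)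
          · exact mul_nonneg (Real.exp_nonneg _) (integral_nonneg fun _ => Real.exp_nonneg _)
          · exact mul_le_mul_of_nonneg_left (hin a) (Real.exp_nonneg _)
      _ = mgf (fun a => g a - ∫ b, g b ∂μ) μ t *
            Real.exp ((n * (c / 2) ^ 2 : ℝ≥0) * t ^ 2 / 2) := by
          rw [integral_mul_const, mgf, hEg]
      _ ≤ Real.exp (((c / 2) ^ 2 : ℝ≥0) * t ^ 2 / 2) *
            Real.exp ((n * (c / 2) ^ 2 : ℝ≥0) * t ^ 2 / 2) := by
          gcongr
          exact hgsub.mgf_le t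
      _ = _ := by
          rw [← Real.exp_add]
          congr 1
          push_cast
          ring

/-- **McDiarmid's inequality.** -/
theorem measure_pi_ge_le_of_bounded_differences {α : Type*} [MeasurableSpace α]
    (μ : Measure α) [IsProbabilityMeasure μ] {c : ℝ≥0} {C : ℝ} {n : ℕ} {f : (Fin n → α) → ℝ}
    (hf : Measurable f) (hC : ∀ x, |f x| ≤ C)
    (hd : ∀ x i y, |f (Function.update x i y) - f x| ≤ c) {t : ℝ} (ht : 0 ≤ t) :
    (Measure.pi fun _ : Fin n => μ).real
        {x | t ≤ f x - ∫ y, f y ∂(Measure.pi fun _ : Fin n => μ)}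
      ≤ Real.exp (-t ^ 2 / (2 * (n * (c / 2) ^ 2))) := by
  simpa using (hasSubgaussianMGF_pi_of_bounded_differences μ n f hf hC hd).measure_ge_le ht

/-! ### Concentration of empirical means in a Hilbert space. -/

section HilbertConcentration

variable {α H : Type*} [MeasurableSpace α] [NormedAddCommGroup H] [InnerProductSpace ℝ H]

/-- The weak (Pettis) mean of a bounded weakly measurable random element of a Hilbert space. -/
theorem exists_weak_mean [CompleteSpace H] (μ : Measure α) [IsProbabilityMeasure μ] {ξ : α → H}
    {B : ℝ} (hB : ∀ x, ‖ξ x‖ ≤ B) (hw : ∀ u, Measurable fun x => inner ℝ (ξ x) u) :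
    ∃ m : H, ∀ u, ∫ x, inner ℝ (ξ x) u ∂μ = inner ℝ m u := by
  have hb : ∀ u x, ‖inner ℝ (ξ x) u‖ ≤ B * ‖u‖ := fun u x =>
    (norm_inner_le_norm _ _).trans (by gcongr; exact hB x)
  have hi : ∀ u, Integrable (fun x => inner ℝ (ξ x) u) μ := fun u =>
    Integrable.of_bound (hw u).aestronglyMeasurable _ (Filter.Eventually.of_forall (hb u))
  -- Riesz representation of the averaged functional. Only weak measurability is used, since the
  -- `L²` spaces to come need not be separable.
  let L : H →ₗ[ℝ] ℝ :=
    { toFun := fun u => ∫ x, inner ℝ (ξ x) u ∂μ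
      map_add' := fun u v => by
        simp only [inner_add_right]; exact integral_add (hi u) (hi v)
      map_smul' := fun r u => by
        simp only [inner_smul_right, integral_const_mul, RingHom.id_apply, smul_eq_mul] }
  let L' : H →L[ℝ] ℝ := L.mkContinuous B fun u => by
    have := norm_integral_le_of_norm_le_const (μ := μ) (Filter.Eventually.of_forall (hb u))
    simpa [L] using this
  refine ⟨(InnerProductSpace.toDual ℝ H).symm L', fun u => ?_⟩
  rw [InnerProductSpace.toDual_symm_apply]
  rfl

/-- Distinct coordinates are independent; this removes the cross terms of the second moment below.
-/
theorem integral_pi_pair (μ : Measure α) [IsProbabilityMeasure μ] {N : ℕ} {k l : Fin N}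
    (hkl : k ≠ l) {g : α × α → ℝ} (hg : Measurable g) :
    ∫ x, g (x k, x l) ∂(Measure.pi fun _ : Fin N => μ) = ∫ z, g z ∂(μ.prod μ) := by
  have hind : iIndepFun (fun (i : Fin N) (x : Fin N → α) => x i)
      (Measure.pi fun _ : Fin N => μ) :=
    iIndepFun_pi (μ := fun _ : Fin N => μ) (X := fun _ a => a) fun _ => aemeasurable_id
  have h := (indepFun_iff_map_prod_eq_prod_map_map (measurable_pi_apply k).aemeasurable
    (measurable_pi_apply l).aemeasurable).1 (hind.indepFun hkl)
  rw [(measurePreserving_eval (fun _ : Fin N => μ) k).map_eq,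
    (measurePreserving_eval (fun _ : Fin N => μ) l).map_eq] at h
  rw [← h, integral_map (by fun_prop) hg.aestronglyMeasurable]

/-- The second moment of the deviation of a Hilbert space valued empirical mean. -/
theorem integral_norm_sq_empirical_mean_le (μ : Measure α) [IsProbabilityMeasure μ] {ξ : α → H}
    {B : ℝ} {m : H} (hB : ∀ x, ‖ξ x‖ ≤ B) (hw : ∀ u, Measurable fun x => inner ℝ (ξ x) u)
    (hj : Measurable fun z : α × α => inner ℝ (ξ z.1) (ξ z.2))
    (hm : ∀ u, ∫ x, inner ℝ (ξ x) u ∂μ = inner ℝ m u) {N : ℕ} (hN : 1 ≤ N) :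
    Measurable (fun x : Fin N → α => ‖(N : ℝ)⁻¹ • ∑ k, ξ (x k) - m‖) ∧
    ∫ x, ‖(N : ℝ)⁻¹ • ∑ k, ξ (x k) - m‖ ^ 2 ∂(Measure.pi fun _ : Fin N => μ) ≤ B ^ 2 / N := by
  have hN0 : (N : ℝ) ≠ 0 := by positivity
  obtain ⟨x₀⟩ := nonempty_of_isProbabilityMeasure μ
  have hB0 : 0 ≤ B := (norm_nonneg _).trans (hB x₀)
  let g : α × α → ℝ := fun z => inner ℝ (ξ z.1 - m) (ξ z.2 - m)
  have hgexp : ∀ z, g z = inner ℝ (ξ z.1) (ξ z.2) - inner ℝ (ξ z.1) m - inner ℝ (ξ z.2) m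
      + inner ℝ m m := by
    intro z
    simp only [g, inner_sub_left, inner_sub_right]
    rw [real_inner_comm (ξ z.2) m]; ring
  have hgm : Measurable g := by
    rw [show g = _ from funext hgexp]
    exact ((hj.sub ((hw m).comp measurable_fst)).sub ((hw m).comp measurable_snd)).add_const _
  have hgb : ∀ z, ‖g z‖ ≤ (B + ‖m‖) * (B + ‖m‖) := fun z =>
    (norm_inner_le_norm _ _).trans (by
      gcongr <;> exact (norm_sub_le _ _).trans (by gcongr; exact hB _))
  have hsq : ∀ x : Fin N → α, ‖(N : ℝ)⁻¹ • ∑ k, ξ (x k) - m‖ ^ 2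
      = (N : ℝ)⁻¹ ^ 2 * ∑ k, ∑ l, g (x k, x l) := by
    intro x
    have h1 : (N : ℝ)⁻¹ • ∑ k, ξ (x k) - m = (N : ℝ)⁻¹ • ∑ k, (ξ (x k) - m) := by
      rw [Finset.sum_sub_distrib, smul_sub]
      congr 1
      simp [← Nat.cast_smul_eq_nsmul ℝ, smul_smul, hN0]
    rw [h1, norm_smul, mul_pow, ← real_inner_self_eq_norm_sq (∑ k, (ξ (x k) - m)), sum_inner]
    simp only [inner_sum, Real.norm_eq_abs, sq_abs, g]
  have hgk : ∀ k l : Fin N, Measurable fun x : Fin N → α => g (x k, x l) := fun k l =>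
    hgm.comp (by fun_prop)
  have hgi : ∀ k l : Fin N, Integrable (fun x : Fin N → α => g (x k, x l))
      (Measure.pi fun _ : Fin N => μ) := fun k l =>
    Integrable.of_bound (hgk k l).aestronglyMeasurable _
      (Filter.Eventually.of_forall fun x => hgb _)
  constructor
  -- Without strong measurability of `ξ`, the norm is measurable because its square expands into the
  -- measurable pairings `g (x k, x l)`.
  · have : (fun x : Fin N → α => ‖(N : ℝ)⁻¹ • ∑ k, ξ (x k) - m‖)
        = fun x => Real.sqrt ((N : ℝ)⁻¹ ^ 2 * ∑ k, ∑ l, g (x k, x l)) := by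
      funext x
      rw [← hsq, Real.sqrt_sq (norm_nonneg _)]
    rw [this]
    exact (measurable_const.mul (Finset.measurable_sum _ fun k _ =>
      Finset.measurable_sum _ fun l _ => hgk k l)).sqrt
  have hdiag : ∀ k : Fin N,
      ∫ x : Fin N → α, g (x k, x k) ∂(Measure.pi fun _ : Fin N => μ) ≤ B ^ 2 := by
    intro k
    have hmeas : Measurable fun a => g (a, a) := hgm.comp (by fun_prop)
    have h1 : ∫ x : Fin N → α, g (x k, x k) ∂(Measure.pi fun _ : Fin N => μ)
        = ∫ a, g (a, a) ∂μ := by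
      conv_rhs => rw [← (measurePreserving_eval (fun _ : Fin N => μ) k).map_eq]
      rw [integral_map (measurable_pi_apply k).aemeasurable hmeas.aestronglyMeasurable]
    rw [h1]
    have hib : ∀ u, Integrable (fun x => inner ℝ (ξ x) u) μ := fun u =>
      Integrable.of_bound (hw u).aestronglyMeasurable (B * ‖u‖)
        (Filter.Eventually.of_forall fun x =>
          (norm_inner_le_norm _ _).trans (by gcongr; exact hB x))
    calc ∫ a, g (a, a) ∂μ ≤ ∫ a, (B ^ 2 + inner ℝ m m - 2 * inner ℝ (ξ a) m) ∂μ := by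
          refine integral_mono
            (Integrable.of_bound hmeas.aestronglyMeasurable _
              (Filter.Eventually.of_forall fun x => hgb _))
            ((integrable_const _).sub ((hib m).const_mul 2)) fun a => ?_
          simp only [hgexp]
          have : inner ℝ (ξ a) (ξ a) ≤ B ^ 2 := by
            rw [real_inner_self_eq_norm_sq]; gcongr; exact hB a
          linarith
      _ = B ^ 2 - inner ℝ m m := by
          rw [integral_sub (integrable_const _) ((hib m).const_mul 2), integral_const_mul, hm]
          simp; ring
      _ ≤ B ^ 2 := by linarith [real_inner_self_nonneg (x := m)]
  have hoff : ∀ k l : Fin N, k ≠ l →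
      ∫ x : Fin N → α, g (x k, x l) ∂(Measure.pi fun _ : Fin N => μ) = 0 := by
    intro k l hkl
    rw [integral_pi_pair μ hkl hgm, integral_prod]
    · refine integral_eq_zero_of_ae (Filter.Eventually.of_forall fun a => ?_)
      have hib : ∀ u, Integrable (fun x => inner ℝ (ξ x) u) μ := fun u =>
        Integrable.of_bound (hw u).aestronglyMeasurable (B * ‖u‖)
          (Filter.Eventually.of_forall fun x =>
            (norm_inner_le_norm _ _).trans (by gcongr; exact hB x))
      have : (fun y => g (a, y)) = fun y => inner ℝ (ξ y) (ξ a - m) - inner ℝ m (ξ a - m) := by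
        funext y
        simp only [g]
        rw [real_inner_comm, inner_sub_left]
      simp only [this]
      rw [integral_sub (hib _) (integrable_const _), hm]
      simp
    · exact Integrable.of_bound hgm.aestronglyMeasurable _ (Filter.Eventually.of_forall hgb)
  simp only [hsq]
  rw [integral_const_mul, integral_finsetSum _ fun k _ => integrable_finsetSum _ fun l _ => hgi k l]
  have h2 : ∀ k : Fin N, ∫ x : Fin N → α, ∑ l, g (x k, x l) ∂(Measure.pi fun _ : Fin N => μ)
      ≤ B ^ 2 := by
    intro k
    rw [integral_finsetSum _ fun l _ => hgi k l, Finset.sum_eq_single k]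
    · exact hdiag k
    · intro l _ hl; exact hoff k l hl.symm
    · simp
  calc (N : ℝ)⁻¹ ^ 2 * ∑ k : Fin N,
        ∫ x : Fin N → α, ∑ l, g (x k, x l) ∂(Measure.pi fun _ : Fin N => μ)
      ≤ (N : ℝ)⁻¹ ^ 2 * ∑ _k : Fin N, B ^ 2 := by gcongr with k; exact h2 k
    _ = B ^ 2 / N := by simp; field_simp

/-- Concentration of the empirical mean of a bounded random element of a Hilbert space, in the weak
formulation: the deviation is controlled simultaneously along all directions. -/
theorem exists_concentration_event [CompleteSpace H] (μ : Measure α) [IsProbabilityMeasure μ]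
    {ξ : α → H} {B : ℝ} (hB : ∀ x, ‖ξ x‖ ≤ B) (hw : ∀ u, Measurable fun x => inner ℝ (ξ x) u)
    (hj : Measurable fun z : α × α => inner ℝ (ξ z.1) (ξ z.2)) {N : ℕ} (hN : 1 ≤ N)
    {δ : ℝ} (hδ : 0 < δ) (hδ1 : δ ≤ 1) :
    ∃ S : Set (Fin N → α), MeasurableSet S ∧
      (Measure.pi fun _ : Fin N => μ).real Sᶜ ≤ δ ∧
      ∀ x ∈ S, ∀ u, |(N : ℝ)⁻¹ * ∑ k, inner ℝ (ξ (x k)) u - ∫ a, inner ℝ (ξ a) u ∂μ|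
        ≤ B * ((1 + Real.sqrt (2 * Real.log (1 / δ))) / Real.sqrt N) * ‖u‖ := by
  obtain ⟨x₀⟩ := nonempty_of_isProbabilityMeasure μ
  have hB0 : 0 ≤ B := (norm_nonneg _).trans (hB x₀)
  have hN0 : (0 : ℝ) < N := by positivity
  obtain ⟨m, hm⟩ := exists_weak_mean μ hB hw
  obtain ⟨hZm, hZ2⟩ := integral_norm_sq_empirical_mean_le μ hB hw hj hm hN
  -- `B = 0` is separate: the exponent of the tail bound would be `0/0`.
  rcases hB0.eq_or_lt with h0 | hBpos
  · have hξ : ∀ x, ξ x = 0 := fun x => norm_le_zero_iff.1 (h0 ▸ hB x)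
    refine ⟨Set.univ, MeasurableSet.univ, by simp [hδ.le], fun x _ u => ?_⟩
    simp [hξ, ← h0]
  have hmB : ‖m‖ ≤ B := by
    have h1 : ‖m‖ ^ 2 ≤ B * ‖m‖ := by
      rw [← real_inner_self_eq_norm_sq, ← hm]
      have := norm_integral_le_of_norm_le_const (μ := μ) (f := fun x => inner ℝ (ξ x) m)
        (C := B * ‖m‖) (Filter.Eventually.of_forall fun x =>
          (norm_inner_le_norm _ _).trans (by gcongr; exact hB x))
      simpa using (le_abs_self _).trans this
    rcases (norm_nonneg m).eq_or_lt with h | h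
    · rw [← h]; exact hB0
    · nlinarith
  set Z : (Fin N → α) → ℝ := fun x => ‖(N : ℝ)⁻¹ • ∑ k, ξ (x k) - m‖ with hZ
  have hZb : ∀ x, |Z x| ≤ 2 * B := by
    intro x
    rw [abs_of_nonneg (norm_nonneg _)]
    calc Z x ≤ ‖(N : ℝ)⁻¹ • ∑ k, ξ (x k)‖ + ‖m‖ := norm_sub_le _ _
      _ ≤ (N : ℝ)⁻¹ * ∑ _k : Fin N, B + B := by
        rw [norm_smul, Real.norm_eq_abs, abs_of_pos (by positivity)]
        gcongr
        exact (norm_sum_le _ _).trans (Finset.sum_le_sum fun k _ => hB _)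
      _ = 2 * B := by simp; field_simp; ring
  -- Replacing one sample point moves the mean by at most `2B/N`.
  obtain ⟨c, hc⟩ : ∃ c : ℝ≥0, (c : ℝ) = 2 * B / N := ⟨⟨2 * B / N, by positivity⟩, rfl⟩
  have hZd : ∀ x i y, |Z (Function.update x i y) - Z x| ≤ c := by
    intro x i y
    rw [hc]
    refine (abs_norm_sub_norm_le _ _).trans ?_
    have : (N : ℝ)⁻¹ • ∑ k, ξ (Function.update x i y k) - m - ((N : ℝ)⁻¹ • ∑ k, ξ (x k) - m)
        = (N : ℝ)⁻¹ • (ξ y - ξ (x i)) := by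
      rw [sub_sub_sub_cancel_right, ← smul_sub, ← Finset.sum_sub_distrib,
        Finset.sum_eq_single i]
      · simp
      · intro k _ hk; simp [Function.update_of_ne hk]
      · simp
    rw [this, norm_smul, Real.norm_eq_abs, abs_of_pos (by positivity)]
    have : ‖ξ y - ξ (x i)‖ ≤ 2 * B := (norm_sub_le _ _).trans (by linarith [hB y, hB (x i)])
    calc (N : ℝ)⁻¹ * ‖ξ y - ξ (x i)‖ ≤ (N : ℝ)⁻¹ * (2 * B) := by gcongr
      _ = 2 * B / N := by ring
  have hmean : ∫ x, Z x ∂(Measure.pi fun _ : Fin N => μ) ≤ B / Real.sqrt N := by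
    have hL : MemLp Z 2 (Measure.pi fun _ : Fin N => μ) :=
      MemLp.of_bound hZm.aestronglyMeasurable (2 * B) (Filter.Eventually.of_forall hZb)
    have hv := variance_nonneg Z (Measure.pi fun _ : Fin N => μ)
    -- Nonnegative variance gives `(E Z)² ≤ E Z² ≤ B²/N`.
    rw [variance_eq_sub hL] at hv
    have h2 : (∫ x, Z x ∂(Measure.pi fun _ : Fin N => μ)) ^ 2 ≤ (B / Real.sqrt N) ^ 2 := by
      rw [div_pow, Real.sq_sqrt hN0.le]
      exact (sub_nonneg.1 hv).trans hZ2
    exact le_of_sq_le_sq h2 (by positivity)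
  -- This `t` makes the McDiarmid exponent equal to `-log(1/δ)`.
  set t := B * (Real.sqrt (2 * Real.log (1 / δ)) / Real.sqrt N) with ht
  have hlog : 0 ≤ Real.log (1 / δ) := Real.log_nonneg (by rw [le_div_iff₀ hδ]; linarith)
  have htail := measure_pi_ge_le_of_bounded_differences μ hZm hZb hZd (t := t) (by positivity)
  have hexp : Real.exp (-t ^ 2 / (2 * (N * ((c : ℝ) / 2) ^ 2)))
      = δ := by
    have : -t ^ 2 / (2 * (N * ((c : ℝ) / 2) ^ 2))
        = - Real.log (1 / δ) := by
      rw [hc, ht, mul_pow, div_pow, Real.sq_sqrt (by positivity), Real.sq_sqrt hN0.le]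
      field_simp
    rw [this, one_div, Real.log_inv, neg_neg, Real.exp_log hδ]
  rw [hexp] at htail
  refine ⟨{x | t ≤ Z x - ∫ y, Z y ∂(Measure.pi fun _ : Fin N => μ)}ᶜ,
    (measurableSet_le measurable_const (hZm.sub_const _)).compl, by rwa [compl_compl], ?_⟩
  intro x hx u
  simp only [Set.mem_compl_iff, Set.mem_ofPred_eq, not_le] at hx
  rw [hm]
  have h3 : (N : ℝ)⁻¹ * ∑ k, inner ℝ (ξ (x k)) u - inner ℝ m u
      = inner ℝ ((N : ℝ)⁻¹ • ∑ k, ξ (x k) - m) u := by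
    rw [inner_sub_left, real_inner_smul_left, sum_inner]
  rw [h3]
  refine (abs_real_inner_le_norm _ _).trans ?_
  gcongr
  change Z x ≤ _
  have : B * ((1 + Real.sqrt (2 * Real.log (1 / δ))) / Real.sqrt N) = B / Real.sqrt N + t := by
    rw [ht]; ring
  linarith

end HilbertConcentration

/-- Uniform concentration of empirical averages of a bounded kernel, tested against all
square-integrable functions. -/
theorem exists_kernel_concentration_event {α β : Type*} [MeasurableSpace α] [MeasurableSpace β]
    (μ : Measure α) [IsProbabilityMeasure μ] (ρ : Measure β) [SFinite ρ] {h : α → β → ℝ}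
    (hm : Measurable fun z : α × β => h z.1 z.2) (hL : ∀ x, MemLp (h x) 2 ρ) {B : ℝ} (hB0 : 0 ≤ B)
    (hB : ∀ x, ∫ z, h x z ^ 2 ∂ρ ≤ B ^ 2) {N : ℕ} (hN : 1 ≤ N)
    {δ : ℝ} (hδ : 0 < δ) (hδ1 : δ ≤ 1) :
    ∃ S : Set (Fin N → α), MeasurableSet S ∧
      (Measure.pi fun _ : Fin N => μ).real Sᶜ ≤ δ ∧
      ∀ x ∈ S, ∀ u, MemLp u 2 ρ →
        |(N : ℝ)⁻¹ * ∑ k, ∫ z, u z * h (x k) z ∂ρ - ∫ a, ∫ z, u z * h a z ∂ρ ∂μ|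
        ≤ B * ((1 + Real.sqrt (2 * Real.log (1 / δ))) / Real.sqrt N) *
            Real.sqrt (∫ z, u z ^ 2 ∂ρ) := by
  let ξ : α → Lp ℝ 2 ρ := fun x => (hL x).toLp (h x)
  have hin : ∀ x (u : Lp ℝ 2 ρ), inner ℝ (ξ x) u = ∫ z, u z * h x z ∂ρ := by
    intro x u
    rw [L2.inner_def]
    refine integral_congr_ae ?_
    filter_upwards [(hL x).coeFn_toLp] with z hz
    simp [ξ, hz]
  -- Written with `h` itself rather than with chosen representatives of classes, the pairing is
  -- jointly measurable in `(x, y)`.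
  have hin2 : ∀ x y, inner ℝ (ξ x) (ξ y) = ∫ z, h y z * h x z ∂ρ := by
    intro x y
    rw [hin]
    refine integral_congr_ae ?_
    filter_upwards [(hL y).coeFn_toLp] with z hz
    simp [ξ, hz]
  have hnorm : ∀ x, ‖ξ x‖ ≤ B := by
    intro x
    refine le_of_sq_le_sq ?_ hB0
    rw [← real_inner_self_eq_norm_sq, hin2]
    simpa only [pow_two] using hB x
  have hw : ∀ u, Measurable fun x => inner ℝ (ξ x) u := by
    intro u
    simp only [hin]
    have : StronglyMeasurable (fun z : α × β => u z.2 * h z.1 z.2) :=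
      ((Lp.stronglyMeasurable u).comp_measurable measurable_snd).mul hm.stronglyMeasurable
    exact this.integral_prod_right'.measurable
  have hj : Measurable fun z : α × α => inner ℝ (ξ z.1) (ξ z.2) := by
    simp only [hin2]
    have : StronglyMeasurable (fun w : (α × α) × β => h w.1.2 w.2 * h w.1.1 w.2) :=
      ((hm.comp (by fun_prop : Measurable fun w : (α × α) × β => (w.1.2, w.2))).mul
        (hm.comp (by fun_prop : Measurable fun w : (α × α) × β => (w.1.1, w.2)))).stronglyMeasurable
    exact this.integral_prod_right'.measurable
  obtain ⟨S, hS, hSδ, hSu⟩ := exists_concentration_event μ hnorm hw hj hN hδ hδ1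
  refine ⟨S, hS, hSδ, fun x hx u hu => ?_⟩
  have h1 : ∀ a, inner ℝ (ξ a) (hu.toLp u) = ∫ z, u z * h a z ∂ρ := by
    intro a
    rw [hin]
    refine integral_congr_ae ?_
    filter_upwards [hu.coeFn_toLp] with z hz
    rw [hz]
  have h2 : ‖hu.toLp u‖ = Real.sqrt (∫ z, u z ^ 2 ∂ρ) := by
    rw [← Real.sqrt_sq (norm_nonneg _), ← real_inner_self_eq_norm_sq, L2.inner_def]
    congr 1
    refine integral_congr_ae ?_
    filter_upwards [hu.coeFn_toLp] with z hz
    simp [hz, pow_two]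
  have := hSu x hx (hu.toLp u)
  simp only [h1, h2] at this
  exact this

/-! ### Averaging operators of bistochastic kernels. -/

theorem eLpNorm_two_sq {α : Type*} [MeasurableSpace α] (μ : Measure α) (f : α → ℝ) :
    eLpNorm f 2 μ ^ 2 = ∫⁻ x, ‖f x‖ₑ ^ 2 ∂μ := by
  have := eLpNorm_nnreal_pow_eq_lintegral (f := f) (μ := μ) (p := 2) two_ne_zero
  simp only [NNReal.coe_ofNat, ENNReal.rpow_ofNat, ENNReal.coe_ofNat] at this
  exact this

/-- A joint density `k` with respect to `μ ⊗ ν` both of whose marginal densities are `1`. -/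
structure IsBistochastic {α β : Type*} [MeasurableSpace α] [MeasurableSpace β]
    (k : α → β → ℝ≥0) (μ : Measure α) (ν : Measure β) : Prop where
  measurable : Measurable fun z : α × β => k z.1 z.2
  lintegral_right : ∀ᵐ x ∂μ, ∫⁻ y, (k x y : ℝ≥0∞) ∂ν = 1
  lintegral_left : ∀ᵐ y ∂ν, ∫⁻ x, (k x y : ℝ≥0∞) ∂μ = 1

/-- The averaging operator with kernel `k`. -/
noncomputable def kernelAvg {α β : Type*} [MeasurableSpace α] (μ : Measure α) (k : α → β → ℝ≥0)
    (f : α → ℝ) (y : β) : ℝ :=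
  ∫ x, f x * k x y ∂μ

section Avg

set_option linter.unusedSectionVars false

variable {α β : Type*} [MeasurableSpace α] [MeasurableSpace β] {μ : Measure α} {ν : Measure β}
  {k : α → β → ℝ≥0}

theorem kernelAvg_congr_ae {f g : α → ℝ} (h : f =ᵐ[μ] g) :
    kernelAvg μ k f = kernelAvg μ k g := by
  funext y
  refine integral_congr_ae ?_
  filter_upwards [h] with x hx
  rw [hx]

theorem kernelAvg_smul (c : ℝ) (f : α → ℝ) :
    kernelAvg μ k (c • f) = c • kernelAvg μ k f := by
  funext y
  simp only [kernelAvg, Pi.smul_apply, smul_eq_mul, mul_assoc, integral_const_mul]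

/-- Jensen's inequality for an averaging operator. -/
theorem enorm_kernelAvg_sq_le {y : β} (hk : Measurable fun x => k x y)
    (h1 : ∫⁻ x, (k x y : ℝ≥0∞) ∂μ = 1) {f : α → ℝ} (hf : AEStronglyMeasurable f μ) :
    ‖kernelAvg μ k f y‖ₑ ^ 2 ≤ ∫⁻ x, ‖f x‖ₑ ^ 2 * k x y ∂μ := by
  -- `k(·,y)` is a probability density, so the claim is `‖f‖₁ ≤ ‖f‖₂` under `Q`.
  let Q := μ.withDensity fun x => (k x y : ℝ≥0∞)
  have hQ : IsProbabilityMeasure Q := ⟨by simp [Q, h1]⟩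
  have hkm : Measurable fun x => (k x y : ℝ≥0∞) := hk.coe_nnreal_ennreal
  have hfQ : AEStronglyMeasurable f Q := hf.mono_ac (withDensity_absolutelyContinuous _ _)
  have e1 : ∀ g : α → ℝ≥0∞, ∫⁻ x, g x * k x y ∂μ = ∫⁻ x, g x ∂Q := by
    intro g
    rw [lintegral_withDensity_eq_lintegral_mul_non_measurable _ hkm
      (Filter.Eventually.of_forall fun _ => ENNReal.coe_lt_top)]
    simp [mul_comm]
  calc ‖kernelAvg μ k f y‖ₑ ^ 2 ≤ (∫⁻ x, ‖f x‖ₑ * k x y ∂μ) ^ 2 := by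
        gcongr
        refine (enorm_integral_le_lintegral_enorm _).trans (le_of_eq (lintegral_congr fun x => ?_))
        rw [enorm_mul]
        congr 1
        rw [Real.enorm_of_nonneg (k x y).coe_nonneg, ENNReal.ofReal_coe_nnreal]
    _ = eLpNorm f 1 Q ^ 2 := by rw [e1, eLpNorm_one_eq_lintegral_enorm]
    _ ≤ eLpNorm f 2 Q ^ 2 := by
        gcongr
        exact eLpNorm_le_eLpNorm_of_exponent_le (by norm_num) hfQ
    _ = _ := by rw [eLpNorm_two_sq, e1]

theorem integrable_of_lintegral_eq_one {y : β} (hk : Measurable fun x => k x y)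
    (h1 : ∫⁻ x, (k x y : ℝ≥0∞) ∂μ = 1) : Integrable (fun x => (k x y : ℝ)) μ :=
  ⟨by fun_prop, by simp [HasFiniteIntegral, h1]⟩

theorem kernelAvg_one {y : β} (hk : Measurable fun x => k x y)
    (h1 : ∫⁻ x, (k x y : ℝ≥0∞) ∂μ = 1) : kernelAvg μ k (fun _ => 1) y = 1 := by
  simp only [kernelAvg, one_mul]
  rw [integral_eq_lintegral_of_nonneg_ae (Filter.Eventually.of_forall fun x => (k x y).coe_nonneg)
    (integrable_of_lintegral_eq_one hk h1).1]
  simp [h1]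

theorem abs_kernelAvg_le {y : β} (hk : Measurable fun x => k x y)
    (h1 : ∫⁻ x, (k x y : ℝ≥0∞) ∂μ = 1) {f : α → ℝ} {c : ℝ}
    (hfc : ∀ᵐ x ∂μ, |f x| ≤ c) : |kernelAvg μ k f y| ≤ c := by
  have h2 := kernelAvg_one hk h1
  simp only [kernelAvg, one_mul] at h2
  calc |kernelAvg μ k f y| ≤ ∫ x, c * k x y ∂μ := by
        rw [← Real.norm_eq_abs]
        refine norm_integral_le_of_norm_le
          ((integrable_of_lintegral_eq_one hk h1).const_mul c) ?_
        filter_upwards [hfc] with x hx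
        rw [norm_mul, Real.norm_eq_abs, NNReal.norm_eq]
        gcongr
    _ = c := by rw [integral_const_mul, h2, mul_one]

namespace IsBistochastic

theorem swap (h : IsBistochastic k μ ν) : IsBistochastic (fun y x => k x y) ν μ where
  measurable := h.measurable.comp measurable_swap
  lintegral_right := h.lintegral_left
  lintegral_left := h.lintegral_right

theorem measurable_left (h : IsBistochastic k μ ν) (y : β) : Measurable fun x => k x y :=
  h.measurable.comp measurable_prodMk_right

theorem measurable_right (h : IsBistochastic k μ ν) (x : α) : Measurable (k x) :=
  h.measurable.comp measurable_prodMk_left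

variable [IsFiniteMeasure μ] [IsFiniteMeasure ν]

theorem aestronglyMeasurable_kernelAvg (h : IsBistochastic k μ ν) {f : α → ℝ}
    (hf : AEStronglyMeasurable f μ) : AEStronglyMeasurable (kernelAvg μ k f) ν := by
  rw [kernelAvg_congr_ae hf.ae_eq_mk]
  have : StronglyMeasurable fun z : β × α => hf.mk f z.2 * k z.2 z.1 :=
    (hf.stronglyMeasurable_mk.comp_measurable measurable_snd).mul
      (h.swap.measurable.coe_nnreal_real.stronglyMeasurable)
  exact this.integral_prod_right'.aestronglyMeasurable

/-- Jensen at almost every `y`, then Tonelli and the other marginal. -/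
theorem eLpNorm_kernelAvg_le (h : IsBistochastic k μ ν) {f : α → ℝ}
    (hf : AEStronglyMeasurable f μ) : eLpNorm (kernelAvg μ k f) 2 ν ≤ eLpNorm f 2 μ := by
  rw [← ENNReal.pow_le_pow_left_iff two_ne_zero, eLpNorm_two_sq, eLpNorm_two_sq]
  have hm : AEMeasurable (fun z : β × α => ‖f z.2‖ₑ ^ 2 * (k z.2 z.1 : ℝ≥0∞)) (ν.prod μ) :=
    ((hf.enorm.comp_quasiMeasurePreserving Measure.quasiMeasurePreserving_snd).pow_const 2).mul
      h.swap.measurable.coe_nnreal_ennreal.aemeasurable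
  calc ∫⁻ y, ‖kernelAvg μ k f y‖ₑ ^ 2 ∂ν ≤ ∫⁻ y, ∫⁻ x, ‖f x‖ₑ ^ 2 * k x y ∂μ ∂ν := by
        refine lintegral_mono_ae ?_
        filter_upwards [h.lintegral_left] with y hy
        exact enorm_kernelAvg_sq_le (h.measurable_left y) hy hf
    _ = ∫⁻ x, ∫⁻ y, ‖f x‖ₑ ^ 2 * k x y ∂ν ∂μ := lintegral_lintegral_swap hm
    _ = ∫⁻ x, ‖f x‖ₑ ^ 2 ∂μ := by
        refine lintegral_congr_ae ?_
        filter_upwards [h.lintegral_right] with x hx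
        rw [lintegral_const_mul _ (h.measurable_right x).coe_nnreal_ennreal, hx, mul_one]

theorem memLp_kernelAvg (h : IsBistochastic k μ ν) {f : α → ℝ} (hf : MemLp f 2 μ) :
    MemLp (kernelAvg μ k f) 2 ν :=
  ⟨h.aestronglyMeasurable_kernelAvg hf.1, (h.eLpNorm_kernelAvg_le hf.1).trans_lt hf.2⟩

theorem integrable_prod (h : IsBistochastic k μ ν) {f : α → ℝ} (hf : Integrable f μ) :
    Integrable (fun z : α × β => f z.1 * k z.1 z.2) (μ.prod ν) := by
  have hm : AEStronglyMeasurable (fun z : α × β => f z.1 * (k z.1 z.2 : ℝ)) (μ.prod ν) :=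
    hf.1.comp_fst.mul h.measurable.coe_nnreal_real.aestronglyMeasurable
  refine ⟨hm, ?_⟩
  rw [HasFiniteIntegral, lintegral_prod _ hm.enorm]
  have : ∫⁻ x, ∫⁻ y, ‖f x * (k x y : ℝ)‖ₑ ∂ν ∂μ = ∫⁻ x, ‖f x‖ₑ ∂μ := by
    refine lintegral_congr_ae ?_
    filter_upwards [h.lintegral_right] with x hx
    simp only [enorm_mul]
    rw [lintegral_const_mul _ (h.measurable_right x).coe_nnreal_real.enorm]
    simp [hx]
  rw [this]
  exact hf.2

/-- Only almost everywhere: at exceptional `y` the two integrands may fail to be integrable. -/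
theorem kernelAvg_add (h : IsBistochastic k μ ν) {f g : α → ℝ} (hf : Integrable f μ)
    (hg : Integrable g μ) :
    kernelAvg μ k (f + g) =ᵐ[ν] kernelAvg μ k f + kernelAvg μ k g := by
  filter_upwards [(h.integrable_prod hf).prod_left_ae, (h.integrable_prod hg).prod_left_ae]
    with y h1 h2
  simp only [kernelAvg, Pi.add_apply, add_mul]
  exact integral_add h1 h2

/-- Fubini; absolute integrability follows from `|f g| ≤ f² + g²` and the two marginals. -/
theorem integral_kernelAvg_mul (h : IsBistochastic k μ ν) {f : α → ℝ} {g : β → ℝ}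
    (hf : MemLp f 2 μ) (hg : MemLp g 2 ν) :
    ∫ y, kernelAvg μ k f y * g y ∂ν = ∫ x, f x * kernelAvg ν (fun y x => k x y) g x ∂μ := by
  have hi : Integrable (fun z : α × β => f z.1 * g z.2 * k z.1 z.2) (μ.prod ν) := by
    have h1 := h.integrable_prod hf.integrable_sq
    have h2 := (h.swap.integrable_prod hg.integrable_sq).swap
    refine (h1.add h2).mono' ((hf.1.comp_fst.mul hg.1.comp_snd).mul
      h.measurable.coe_nnreal_real.aestronglyMeasurable) (Filter.Eventually.of_forall fun z => ?_)
    simp only [Pi.add_apply, Function.comp_apply, Prod.fst_swap, Prod.snd_swap, norm_mul,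
      Real.norm_eq_abs, NNReal.abs_eq, ← add_mul]
    gcongr
    nlinarith [sq_nonneg (|f z.1| - |g z.2|), sq_abs (f z.1), sq_abs (g z.2),
      mul_nonneg (abs_nonneg (f z.1)) (abs_nonneg (g z.2))]
  have e1 : ∀ y, kernelAvg μ k f y * g y = ∫ x, f x * g y * k x y ∂μ := fun y => by
    rw [kernelAvg, ← integral_mul_const]
    exact integral_congr_ae (Filter.Eventually.of_forall fun x => by simp only; ring)
  have e2 : ∀ x, f x * kernelAvg ν (fun y x => k x y) g x = ∫ y, f x * g y * k x y ∂ν := fun x => by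
    rw [kernelAvg, ← integral_const_mul]
    exact integral_congr_ae (Filter.Eventually.of_forall fun x => by simp only; ring)
  simp only [e1, e2]
  exact (integral_integral_swap hi).symm

/-- The averaging operator as a continuous linear map between `L²` spaces. -/
noncomputable def avgL (h : IsBistochastic k μ ν) :
    Lp ℝ 2 μ →L[ℝ] Lp ℝ 2 ν :=
  LinearMap.mkContinuous
    { toFun := fun f => (h.memLp_kernelAvg (Lp.memLp f)).toLp _
      map_add' := fun f g => by
        have hf := (Lp.memLp f).integrable one_le_two
        have hg := (Lp.memLp g).integrable one_le_two
        rw [← MemLp.toLp_add, MemLp.toLp_eq_toLp_iff, kernelAvg_congr_ae (Lp.coeFn_add f g)]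
        exact h.kernelAvg_add hf hg
      map_smul' := fun c f => by
        simp only [RingHom.id_apply]
        rw [← MemLp.toLp_const_smul, MemLp.toLp_eq_toLp_iff,
          kernelAvg_congr_ae (Lp.coeFn_smul c f), kernelAvg_smul] }
    1 fun f => by
      simp only [LinearMap.coe_mk, AddHom.coe_mk, one_mul]
      rw [Lp.norm_toLp, Lp.norm_def]
      exact ENNReal.toReal_mono (Lp.eLpNorm_ne_top f)
        (h.eLpNorm_kernelAvg_le (Lp.aestronglyMeasurable f))

section

variable (h : IsBistochastic k μ ν)

theorem coeFn_avgL (f : Lp ℝ 2 μ) : h.avgL f =ᵐ[ν] kernelAvg μ k f :=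
  (h.memLp_kernelAvg (Lp.memLp f)).coeFn_toLp

theorem norm_avgL_le (f : Lp ℝ 2 μ) : ‖h.avgL f‖ ≤ ‖f‖ := by
  have := h.avgL.le_of_opNorm_le (LinearMap.mkContinuous_norm_le _ zero_le_one _) f
  simpa using this

theorem avgL_toLp {f : α → ℝ} (hf : MemLp f 2 μ) :
    h.avgL (hf.toLp f) = (h.memLp_kernelAvg hf).toLp _ := by
  rw [avgL]
  refine (MemLp.toLp_eq_toLp_iff (h.memLp_kernelAvg (Lp.memLp _)) _).2 ?_
  rw [kernelAvg_congr_ae hf.coeFn_toLp]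

theorem inner_avgL (f : Lp ℝ 2 μ) (g : Lp ℝ 2 ν) :
    inner ℝ (h.avgL f) g = inner ℝ f (h.swap.avgL g) := by
  rw [L2.inner_def, L2.inner_def]
  have e1 : ∫ y, inner ℝ (h.avgL f y) (g y) ∂ν = ∫ y, kernelAvg μ k f y * g y ∂ν := by
    refine integral_congr_ae ?_
    filter_upwards [h.coeFn_avgL f] with y hy
    rw [hy]; simp [mul_comm]
  have e2 : ∫ x, inner ℝ (f x) (h.swap.avgL g x) ∂μ
      = ∫ x, f x * kernelAvg ν (fun y x => k x y) g x ∂μ := by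
    refine integral_congr_ae ?_
    filter_upwards [h.swap.coeFn_avgL g] with x hx
    rw [hx]; simp [mul_comm]
  rw [e1, e2, h.integral_kernelAvg_mul (Lp.memLp f) (Lp.memLp g)]

end

end IsBistochastic

end Avg

/-! ### Sorted eigenvalues as suprema, and Ky Fan's inequality. -/

section SortedEig

variable {H H' : Type*} [NormedAddCommGroup H] [InnerProductSpace ℝ H]
  [NormedAddCommGroup H'] [InnerProductSpace ℝ H']

/-- The lower bounds for the eigenvalues of orthonormal families of `n + 1` eigenvectors. -/
def eigSet (T : H →ₗ[ℝ] H) (n : ℕ) : Set ℝ :=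
  {t | ∃ (s : Fin (n + 1) → ℝ) (e : Fin (n + 1) → H),
    (Orthonormal ℝ e ∧ ∀ i, T (e i) = s i • e i) ∧ ∀ i, t ≤ s i}

/-- The `n`-th largest eigenvalue, as a supremum over orthonormal families of eigenvectors. -/
noncomputable def sortedEig (T : H →ₗ[ℝ] H) (n : ℕ) : ℝ := sSup (eigSet T n)

/-- Given `n` orthonormal eigenvectors of a symmetric operator and `n + 1` others with eigenvalues at
least `t`, the first family can be extended by an eigenvector with eigenvalue at least `t`. -/
theorem LinearMap.IsSymmetric.exists_eigenvector_orthogonal {T : H →ₗ[ℝ] H} (hT : T.IsSymmetric)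
    {n : ℕ} {s : Fin n → ℝ} {e : Fin n → H} (he : Orthonormal ℝ e)
    (hs : ∀ i, T (e i) = s i • e i) {s' : Fin (n + 1) → ℝ} {e' : Fin (n + 1) → H}
    (he' : Orthonormal ℝ e') (hs' : ∀ i, T (e' i) = s' i • e' i) :
    ∃ (j : Fin (n + 1)) (w : H), ‖w‖ = 1 ∧ T w = s' j • w ∧ ∀ i, inner ℝ (e i) w = 0 := by
  -- Otherwise `n + 1` independent vectors would lie in a span of dimension `n`.
  obtain ⟨j, hj⟩ : ∃ j, e' j ∉ Submodule.span ℝ (Set.range e) := by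
    by_contra! hcon
    have hle : Submodule.span ℝ (Set.range e') ≤ Submodule.span ℝ (Set.range e) :=
      Submodule.span_le.2 (by rintro _ ⟨j, rfl⟩; exact hcon j)
    have hfin : FiniteDimensional ℝ (Submodule.span ℝ (Set.range e)) :=
      FiniteDimensional.span_of_finite ℝ (Set.finite_range e)
    have h1 := Submodule.finrank_mono hle
    rw [finrank_span_eq_card he'.linearIndependent, finrank_span_eq_card he.linearIndependent] at h1
    simp at h1
  set w := e' j - ∑ i, (inner ℝ (e i) (e' j) : ℝ) • e i with hw
  have hw0 : w ≠ 0 := by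
    intro h0
    apply hj
    rw [sub_eq_zero.1 h0]
    exact Submodule.sum_mem _ fun i _ => Submodule.smul_mem _ _ (Submodule.subset_span ⟨i, rfl⟩)
  have horth : ∀ i, inner ℝ (e i) w = 0 := by
    intro i
    rw [hw, inner_sub_right, he.inner_right_fintype, sub_self]
  have hTw : T w = s' j • w := by
    -- By symmetry `e i` and `e' j` are orthogonal unless their eigenvalues agree, so subtracting
    -- the projection keeps the eigen-equation.
    have hcoef : ∀ i, (inner ℝ (e i) (e' j) : ℝ) * s i = s' j * inner ℝ (e i) (e' j) := by
      intro i
      have := hT (e i) (e' j)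
      rw [hs, hs', real_inner_smul_left, real_inner_smul_right] at this
      linarith
    rw [hw, map_sub, map_sum, hs', smul_sub, Finset.smul_sum]
    congr 1
    refine Finset.sum_congr rfl fun i _ => ?_
    rw [map_smul, hs, smul_smul, smul_smul, hcoef]
  refine ⟨j, (‖w‖⁻¹ : ℝ) • w, ?_, ?_, fun i => ?_⟩
  · rw [norm_smul, norm_inv, norm_norm, inv_mul_cancel₀ (norm_ne_zero_iff.2 hw0)]
  · rw [map_smul, hTw, smul_comm]
  · rw [real_inner_smul_right, horth, mul_zero]

theorem Orthonormal.snoc {n : ℕ} {e : Fin n → H} (he : Orthonormal ℝ e) {w : H} (hw : ‖w‖ = 1)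
    (h : ∀ i, inner ℝ (e i) w = 0) :
    Orthonormal ℝ (Fin.snoc (α := fun _ => H) e w : Fin (n + 1) → H) := by
  constructor
  · intro i
    refine Fin.lastCases ?_ (fun i => ?_) i
    · simpa using hw
    · simpa using he.1 i
  · intro i j
    refine Fin.lastCases ?_ (fun i => ?_) i <;> refine Fin.lastCases ?_ (fun j => ?_) j
    · intro h; exact absurd rfl h
    · intro _; simpa [real_inner_comm] using h j
    · intro _; simpa using h i
    · intro hij
      simpa using he.2 (fun h => hij (by rw [h]))

theorem eigSet_subset {T : H →ₗ[ℝ] H} {m n : ℕ} (hmn : m ≤ n) : eigSet T n ⊆ eigSet T m := by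
  rintro t ⟨s, e, ⟨he, hs⟩, ht⟩
  have h : m + 1 ≤ n + 1 := by omega
  exact ⟨fun i => s (Fin.castLE h i), fun i => e (Fin.castLE h i),
    ⟨he.comp _ (Fin.castLE_injective h), fun i => hs _⟩, fun i => ht _⟩

variable {T : H →ₗ[ℝ] H}

theorem eigenvalue_eq_inner {n : ℕ} {s : Fin n → ℝ} {e : Fin n → H} (he : Orthonormal ℝ e)
    (hs : ∀ i, T (e i) = s i • e i) (i : Fin n) : s i = inner ℝ (T (e i)) (e i) := by
  rw [hs, real_inner_smul_left, real_inner_self_eq_norm_sq, he.1]; simp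

theorem bddAbove_eigSet (hle : ∀ f, inner ℝ (T f) f ≤ ‖f‖ ^ 2) (n : ℕ) :
    BddAbove (eigSet T n) := by
  refine ⟨1, ?_⟩
  rintro t ⟨s, e, ⟨he, hs⟩, ht⟩
  refine (ht 0).trans ?_
  rw [eigenvalue_eq_inner he hs]
  simpa [he.1] using hle (e 0)

theorem sortedEig_nonneg (hpos : ∀ f, 0 ≤ inner ℝ (T f) f) (hle : ∀ f, inner ℝ (T f) f ≤ ‖f‖ ^ 2)
    (n : ℕ) : 0 ≤ sortedEig T n := by
  rcases (eigSet T n).eq_empty_or_nonempty with h | ⟨t, s, e, ⟨he, hs⟩, -⟩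
  · rw [sortedEig, h, Real.sSup_empty]
  · refine le_csSup (bddAbove_eigSet hle n) ⟨s, e, ⟨he, hs⟩, fun i => ?_⟩
    rw [eigenvalue_eq_inner he hs]
    exact hpos _

theorem sortedEig_antitone (hpos : ∀ f, 0 ≤ inner ℝ (T f) f)
    (hle : ∀ f, inner ℝ (T f) f ≤ ‖f‖ ^ 2) : Antitone (sortedEig T) := by
  intro m n hmn
  rcases (eigSet T n).eq_empty_or_nonempty with h | h
  -- When no family of `n + 1` eigenvectors exists the supremum takes the default value `0`, so
  -- nonnegativity is what is needed.
  · conv_lhs => rw [sortedEig, h, Real.sSup_empty]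
    exact sortedEig_nonneg hpos hle m
  · exact csSup_le_csSup (bddAbove_eigSet hle m) h (eigSet_subset hmn)

theorem nonempty_eigSet_of_pos {n : ℕ} (h : 0 < sortedEig T n) : (eigSet T n).Nonempty := by
  by_contra hcon
  rw [sortedEig, Set.not_nonempty_iff_eq_empty.1 hcon, Real.sSup_empty] at h
  exact lt_irrefl _ h

/-- Orthonormal eigenvectors whose eigenvalues are arbitrarily close to the largest ones. -/
theorem exists_orthonormal_eigenvectors (hT : T.IsSymmetric) {ε : ℝ} (hε : 0 < ε) (n : ℕ)
    (hne : ∀ i < n, (eigSet T i).Nonempty) :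
    ∃ (s : Fin n → ℝ) (e : Fin n → H), Orthonormal ℝ e ∧ (∀ i, T (e i) = s i • e i) ∧
      ∀ i : Fin n, sortedEig T i - ε ≤ s i := by
  induction n with
  | zero => exact ⟨Fin.elim0, Fin.elim0, ⟨fun i => i.elim0, fun i => i.elim0⟩, fun i => i.elim0,
      fun i => i.elim0⟩
  | succ n ih =>
    obtain ⟨s, e, he, hs, hse⟩ := ih fun i hi => hne i (by omega)
    -- All eigenvalues of this near-optimal family exceed `sortedEig T n - ε`, so whichever member
    -- supplies the new vector will do.
    obtain ⟨t, ⟨s', e', ⟨he', hs'⟩, ht⟩, htlt⟩ := exists_lt_of_lt_csSup (hne n (by omega))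
      (show sortedEig T n - ε < sSup (eigSet T n) by rw [sortedEig]; linarith)
    obtain ⟨j, w, hw1, hTw, hwo⟩ := hT.exists_eigenvector_orthogonal he hs he' hs'
    refine ⟨Fin.snoc (α := fun _ => ℝ) s (s' j), Fin.snoc (α := fun _ => H) e w,
      he.snoc hw1 hwo, fun i => ?_, fun i => ?_⟩
    · refine Fin.lastCases ?_ (fun i => ?_) i
      · simpa using hTw
      · simpa using hs i
    · refine Fin.lastCases ?_ (fun i => ?_) i
      · simpa using htlt.le.trans (ht j)
      · simpa using hse i

/-- Bathtub principle: weight beyond the first `d` indices counts at most `s d` per unit, and it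
fits into the room `1 - w i` left among them, where each unit counts at least `s d`. -/
theorem sum_mul_le_sum_of_antitone {s w : ℕ → ℝ} (hs : Antitone s) (hs0 : ∀ i, 0 ≤ s i)
    (hw0 : ∀ i, 0 ≤ w i) (hw1 : ∀ i, w i ≤ 1) (d m : ℕ)
    (hsum : ∑ i ∈ Finset.range (d + m), w i ≤ d) :
    ∑ i ∈ Finset.range (d + m), s i * w i ≤ ∑ i ∈ Finset.range d, s i := by
  rw [Finset.sum_range_add] at hsum ⊢
  have h1 : ∑ j ∈ Finset.range m, s (d + j) * w (d + j)
      ≤ s d * ∑ j ∈ Finset.range m, w (d + j) := by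
    rw [Finset.mul_sum]
    exact Finset.sum_le_sum fun j _ => mul_le_mul_of_nonneg_right (hs (by omega)) (hw0 _)
  have h2 : s d * ∑ j ∈ Finset.range m, w (d + j)
      ≤ s d * (d - ∑ i ∈ Finset.range d, w i) :=
    mul_le_mul_of_nonneg_left (by linarith) (hs0 d)
  have h3 : s d * (d - ∑ i ∈ Finset.range d, w i) = ∑ i ∈ Finset.range d, s d * (1 - w i) := by
    rw [← Finset.mul_sum, Finset.sum_sub_distrib]; simp
  have h4 : ∑ i ∈ Finset.range d, (s i * w i + s d * (1 - w i)) ≤ ∑ i ∈ Finset.range d, s i := by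
    refine Finset.sum_le_sum fun i hi => ?_
    have := hs (Finset.mem_range.1 hi).le
    nlinarith [hw1 i]
  rw [Finset.sum_add_distrib] at h4
  linarith

/-- **Ky Fan's inequality** for `B ∘ A`, where `B` is the adjoint of `A`. -/
theorem sum_norm_sq_le_sum_sortedEig [FiniteDimensional ℝ H] {A : H →ₗ[ℝ] H'} {B : H' →ₗ[ℝ] H}
    (hAB : ∀ f g, inner ℝ (A f) g = inner ℝ f (B g)) (hA : ∀ f, ‖A f‖ ≤ ‖f‖)
    {ι : Type*} [Fintype ι] {d : ℕ} (hι : Fintype.card ι ≤ d) {v : ι → H'} (hv : Orthonormal ℝ v) :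
    ∑ i, ‖B (v i)‖ ^ 2 ≤ ∑ j ∈ Finset.range d, sortedEig (B ∘ₗ A) j := by
  set T := B ∘ₗ A with hTdef
  have hT : T.IsSymmetric := fun f g => by
    simp only [T, LinearMap.comp_apply]
    rw [real_inner_comm, ← hAB, ← hAB, real_inner_comm]
  have hTf : ∀ f, inner ℝ (T f) f = ‖A f‖ ^ 2 := fun f => by
    rw [real_inner_comm]
    simp only [T, LinearMap.comp_apply]
    rw [← hAB, real_inner_self_eq_norm_sq]
  have hpos : ∀ f, 0 ≤ inner ℝ (T f) f := fun f => by rw [hTf]; positivity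
  have hle : ∀ f, inner ℝ (T f) f ≤ ‖f‖ ^ 2 := fun f => by
    rw [hTf]; gcongr; exact hA f
  set m := Module.finrank ℝ H with hm
  let b := hT.eigenvectorBasis hm.symm
  let s := hT.eigenvalues hm.symm
  have hb : ∀ l, T (b l) = s l • b l := fun l => by
    exact hT.apply_eigenvectorBasis hm.symm l
  -- The first `l + 1` vectors of the eigenbasis witness the supremum.
  have hsort : ∀ l : Fin m, s l ≤ sortedEig T l := by
    intro l
    refine le_csSup (bddAbove_eigSet hle l) ⟨fun i => s (Fin.castLE l.2 i),
      fun i => b (Fin.castLE l.2 i), ⟨b.orthonormal.comp _ (Fin.castLE_injective _),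
        fun i => hb _⟩, fun i => ?_⟩
    refine hT.eigenvalues_antitone hm.symm ?_
    rw [Fin.le_def]
    exact Nat.lt_succ_iff.1 i.2
  have hAb : ∀ l l', inner ℝ (A (b l)) (A (b l')) = if l = l' then s l else 0 := by
    intro l l'
    rw [hAB]
    change inner ℝ (b l) (T (b l')) = _
    rw [hb, real_inner_smul_right, orthonormal_iff_ite.1 b.orthonormal l l']
    split_ifs with h
    · rw [h, mul_one]
    · rw [mul_zero]
  have hs0 : ∀ l, 0 ≤ s l := fun l => by
    have := hAb l l
    rw [if_pos rfl] at this
    rw [← this]; exact real_inner_self_nonneg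
  -- The vectors `A (b l)` are orthogonal with squared norms `s l`. Bessel for the family `v` gives
  -- `c l ≤ s l`; Bessel for the normalized `A (b l)` gives `∑ c l / s l ≤ d`.
  let c : Fin m → ℝ := fun l => ∑ i, inner ℝ (A (b l)) (v i) ^ 2
  have hc0 : ∀ l, 0 ≤ c l := fun l => Finset.sum_nonneg fun i _ => sq_nonneg _
  have hcs : ∀ l, c l ≤ s l := by
    intro l
    have h1 := hv.sum_inner_products_le (A (b l)) (s := Finset.univ)
    have h2 := hAb l l
    rw [if_pos rfl, real_inner_self_eq_norm_sq] at h2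
    rw [h2] at h1
    refine le_trans (le_of_eq (Finset.sum_congr rfl fun i _ => ?_)) h1
    rw [real_inner_comm, Real.norm_eq_abs, sq_abs]
  have hBv : ∀ i, ‖B (v i)‖ ^ 2 = ∑ l, inner ℝ (A (b l)) (v i) ^ 2 := by
    intro i
    rw [← b.sum_sq_norm_inner_right]
    refine Finset.sum_congr rfl fun l _ => ?_
    rw [hAB, Real.norm_eq_abs, sq_abs]
  have hbes : ∀ i, ∑ l, inner ℝ (A (b l)) (v i) ^ 2 / s l ≤ 1 := by
    intro i
    set q := ∑ l, inner ℝ (A (b l)) (v i) ^ 2 / s l with hq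
    let y := ∑ l, (inner ℝ (A (b l)) (v i) / s l) • A (b l)
    have h1 : inner ℝ y (v i) = q := by
      simp only [y, sum_inner, real_inner_smul_left, hq]
      refine Finset.sum_congr rfl fun l _ => ?_
      ring
    have h2 : inner ℝ y y = q := by
      simp only [y, sum_inner, inner_sum, real_inner_smul_left, real_inner_smul_right, hAb, hq]
      refine Finset.sum_congr rfl fun l _ => ?_
      rw [Finset.sum_eq_single l]
      · rw [if_pos rfl]
        rcases (hs0 l).eq_or_lt with h | h
        · rw [← h]; simp
        · field_simp
      · intro l' _ hl'; rw [if_neg hl']; ring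
      · simp
    have h3 : 0 ≤ inner ℝ (v i - y) (v i - y) := real_inner_self_nonneg
    rw [inner_sub_left, inner_sub_right, inner_sub_right, h2, h1, real_inner_comm y, h1,
      real_inner_self_eq_norm_sq, hv.1] at h3
    linarith
  -- The weights are extended by zero because `d` may exceed the dimension of `H`.
  let w : ℕ → ℝ := fun l => if h : l < m then c ⟨l, h⟩ / s ⟨l, h⟩ else 0
  have hwFin : ∀ l : Fin m, w l = c l / s l := fun l => by simp [w]
  have hw0 : ∀ l, 0 ≤ w l := fun l => by
    simp only [w]; split_ifs
    · exact div_nonneg (hc0 _) (hs0 _)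
    · exact le_rfl
  have hw1 : ∀ l, w l ≤ 1 := fun l => by
    simp only [w]; split_ifs
    · exact div_le_one_of_le₀ (hcs _) (hs0 _)
    · exact zero_le_one
  have hext : ∀ g : ℕ → ℝ, (∀ l, m ≤ l → g l = 0) →
      ∑ l ∈ Finset.range (d + m), g l = ∑ l : Fin m, g l := by
    intro g hg
    rw [← Finset.sum_range, add_comm, Finset.sum_range_add, add_eq_left]
    exact Finset.sum_eq_zero fun j _ => hg _ (by omega)
  have hwz : ∀ l, m ≤ l → w l = 0 := fun l hl => by simp [w, not_lt.2 hl]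
  have hwsum : ∑ l ∈ Finset.range (d + m), w l ≤ d := by
    rw [hext w hwz]
    calc ∑ l : Fin m, w l = ∑ l, ∑ i, inner ℝ (A (b l)) (v i) ^ 2 / s l :=
          Finset.sum_congr rfl fun l _ => by rw [hwFin, Finset.sum_div]
      _ = ∑ i, ∑ l, inner ℝ (A (b l)) (v i) ^ 2 / s l := Finset.sum_comm
      _ ≤ ∑ _i : ι, 1 := Finset.sum_le_sum fun i _ => hbes i
      _ ≤ d := by simpa using hι
  calc ∑ i, ‖B (v i)‖ ^ 2 = ∑ l, c l := by
        simp only [hBv]; exact Finset.sum_comm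
    _ ≤ ∑ l : Fin m, sortedEig T l * w l := by
        refine Finset.sum_le_sum fun l _ => ?_
        have : c l = s l * w l := by
          rw [hwFin]
          rcases (hs0 l).eq_or_lt with h | h
          · rw [← h, zero_mul]; exact le_antisymm (h ▸ hcs l) (hc0 l)
          · field_simp
        rw [this]
        exact mul_le_mul_of_nonneg_right (hsort l) (hw0 _)
    _ = ∑ l ∈ Finset.range (d + m), sortedEig T l * w l :=
        (hext (fun l => sortedEig T l * w l) fun l hl => by rw [hwz l hl, mul_zero]).symm
    _ ≤ _ := sum_mul_le_sum_of_antitone (sortedEig_antitone hpos hle)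
        (sortedEig_nonneg hpos hle) hw0 hw1 d m hwsum

end SortedEig

/-! ### From eigenfunctions to eigenvectors in `L²`. -/

theorem inner_toLp_eq {α : Type*} [MeasurableSpace α] {μ : Measure α} {f g : α → ℝ}
    (hf : MemLp f 2 μ) (hg : MemLp g 2 μ) :
    inner ℝ (hf.toLp f) (hg.toLp g) = ∫ z, f z * g z ∂μ := by
  rw [L2.inner_def]
  refine integral_congr_ae ?_
  filter_upwards [hf.coeFn_toLp, hg.coeFn_toLp] with z h1 h2
  rw [h1, h2]
  simp [mul_comm]

theorem gramL2_eq_one_iff {α : Type*} [MeasurableSpace α] {μ : Measure α} {n : ℕ}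
    {e : Fin n → α → ℝ} (he : ∀ i, MemLp (e i) 2 μ) :
    gramL2 μ e = 1 ↔ Orthonormal ℝ fun i => (he i).toLp (e i) := by
  rw [orthonormal_iff_ite]
  simp only [inner_toLp_eq]
  rw [← Matrix.ext_iff]
  simp [gramL2, Matrix.one_apply]

theorem isEigenfamily_iff {α : Type*} [MeasurableSpace α] {μ : Measure α}
    {T : (α → ℝ) → α → ℝ} {T' : Lp ℝ 2 μ →ₗ[ℝ] Lp ℝ 2 μ}
    (hT : ∀ f (hf : MemLp f 2 μ), T' (hf.toLp f) =ᵐ[μ] T f) {n : ℕ} {s : Fin n → ℝ}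
    {e : Fin n → α → ℝ} (he : ∀ i, MemLp (e i) 2 μ) :
    IsEigenfamily μ T s e ↔ (Orthonormal ℝ fun i => (he i).toLp (e i)) ∧
      ∀ i, T' ((he i).toLp (e i)) = s i • (he i).toLp (e i) := by
  rw [IsEigenfamily, gramL2_eq_one_iff he]
  simp only [he, implies_true, true_and]
  refine and_congr_right fun _ => forall_congr' fun i => ?_
  rw [Lp.ext_iff]
  have h1 := Lp.coeFn_smul (s i) ((he i).toLp (e i))
  have h2 := (he i).coeFn_toLp
  constructor
  · intro h
    filter_upwards [h, h1, h2, hT (e i) (he i)] with z h h1 h2 h3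
    rw [h3, h, h1, Pi.smul_apply, h2, smul_eq_mul]
  · intro h
    filter_upwards [h, h1, h2, hT (e i) (he i)] with z h h1 h2 h3
    rw [← h3, h, h1, Pi.smul_apply, h2, smul_eq_mul]

/-- Eigenfamilies depend only on classes modulo null sets and every class has a representative, so
both suprema run over the same set. -/
theorem sortedEigenvalue_eq_sortedEig {α : Type*} [MeasurableSpace α] {μ : Measure α}
    {T : (α → ℝ) → α → ℝ} {T' : Lp ℝ 2 μ →ₗ[ℝ] Lp ℝ 2 μ}
    (hT : ∀ f (hf : MemLp f 2 μ), T' (hf.toLp f) =ᵐ[μ] T f) (n : ℕ) :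
    sortedEigenvalue μ T n = sortedEig T' n := by
  rw [sortedEigenvalue, sortedEig, eigSet]
  congr 1
  ext t
  constructor
  · rintro ⟨s, e, h, ht⟩
    exact ⟨s, _, (isEigenfamily_iff hT h.1).1 h, ht⟩
  · rintro ⟨s, e, h, ht⟩
    refine ⟨s, fun i => e i, (isEigenfamily_iff hT fun i => Lp.memLp (e i)).2 ?_, ht⟩
    simpa only [Lp.toLp_coeFn] using h

/-! ### `Γ` and `Γ*` as adjoint averaging operators. -/

namespace Augmentation

variable {𝒳 𝒜 : Type*} [MeasurableSpace 𝒳] [MeasurableSpace 𝒜] (M : Augmentation 𝒳 𝒜)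

/-- The density `p(a|x) / p(a)` of the joint law with respect to the product of the marginals. -/
noncomputable def dens (x : 𝒳) (a : 𝒜) : ℝ≥0 := M.p x a / (M.pA a).toNNReal

/-- The law of the augmentations of `x` has no mass where the marginal density vanishes. -/
def Dominated (x : 𝒳) : Prop := ∀ᵐ a ∂M.ν, M.pA a = 0 → M.p x a = 0

theorem measurable_p_right (x : 𝒳) : Measurable (M.p x) :=
  M.measurable_p.comp measurable_prodMk_left

theorem measurable_p_left (a : 𝒜) : Measurable fun x => M.p x a :=
  M.measurable_p.comp measurable_prodMk_right

theorem measurable_pA : Measurable M.pA :=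
  (M.measurable_p.coe_nnreal_ennreal).lintegral_prod_left'

theorem measurable_dens : Measurable fun z : 𝒳 × 𝒜 => M.dens z.1 z.2 :=
  M.measurable_p.div (M.measurable_pA.ennreal_toNNReal.comp measurable_snd)

theorem measurable_dens_right (x : 𝒳) : Measurable (M.dens x) :=
  M.measurable_dens.comp measurable_prodMk_left

theorem lintegral_pA : ∫⁻ a, M.pA a ∂M.ν = 1 := by
  simp only [pA]
  rw [lintegral_lintegral_swap (f := fun a x => (M.p x a : ℝ≥0∞))
    (M.measurable_p.coe_nnreal_ennreal.comp measurable_swap).aemeasurable]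
  simp [M.lintegral_p]

instance : IsProbabilityMeasure M.PA :=
  ⟨by rw [PA, withDensity_apply _ MeasurableSet.univ, Measure.restrict_univ, lintegral_pA]⟩

theorem pA_lt_top : ∀ᵐ a ∂M.ν, M.pA a < ∞ :=
  ae_lt_top M.measurable_pA (by simp [lintegral_pA])

/-- For fixed `a` with `p(a) = 0`, `p(a|x)` vanishes for almost every `x`; Fubini exchanges the
quantifiers. -/
theorem ae_dominated : ∀ᵐ x ∂M.PX, M.Dominated x := by
  have hm : MeasurableSet {z : 𝒳 × 𝒜 | M.pA z.2 = 0 → M.p z.1 z.2 = 0} := by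
    have h1 : MeasurableSet {z : 𝒳 × 𝒜 | M.pA z.2 = 0} :=
      (M.measurable_pA.comp measurable_snd) (measurableSet_singleton 0)
    have h2 : MeasurableSet {z : 𝒳 × 𝒜 | M.p z.1 z.2 = 0} :=
      M.measurable_p (measurableSet_singleton 0)
    exact h1.imp h2
  refine (Measure.ae_ae_comm (μ := M.PX) (ν := M.ν)
    (p := fun x a => M.pA a = 0 → M.p x a = 0) hm).2 (Filter.Eventually.of_forall fun a => ?_)
  by_cases ha : M.pA a = 0
  · rw [pA, lintegral_eq_zero_iff (M.measurable_p_left a).coe_nnreal_ennreal] at ha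
    filter_upwards [ha] with x hx _
    simpa using hx
  · simp [ha]

variable {M}

theorem Dominated.pA_mul_dens {x : 𝒳} (hx : M.Dominated x) :
    ∀ᵐ a ∂M.ν, M.pA a * M.dens x a = M.p x a := by
  filter_upwards [hx, M.pA_lt_top] with a ha htop
  obtain ⟨q, hq⟩ : ∃ q : ℝ≥0, (q : ℝ≥0∞) = M.pA a := ⟨_, ENNReal.coe_toNNReal htop.ne⟩
  rw [dens, ← hq, ENNReal.toNNReal_coe, ← ENNReal.coe_mul]
  congr 1
  by_cases h0 : q = 0
  · rw [h0, zero_mul, ha (by rw [← hq, h0]; rfl)]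
  · exact mul_div_cancel₀ _ h0

theorem Dominated.withDensity_eq {x : 𝒳} (hx : M.Dominated x) :
    M.ν.withDensity (fun a => (M.p x a : ℝ≥0∞)) = M.PA.withDensity fun a => (M.dens x a : ℝ≥0∞) := by
  rw [PA, ← withDensity_mul _ M.measurable_pA
    (M.measurable_dens_right x).coe_nnreal_ennreal]
  refine withDensity_congr_ae ?_
  filter_upwards [hx.pA_mul_dens] with a ha
  rw [← ha]; rfl

variable (M)

theorem isBistochastic : IsBistochastic M.dens M.PX M.PA where
  measurable := M.measurable_dens
  lintegral_right := by
    filter_upwards [M.ae_dominated] with x hx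
    have h := congrArg (fun μ : Measure 𝒜 => μ Set.univ) hx.withDensity_eq
    simp only [withDensity_apply _ MeasurableSet.univ, Measure.restrict_univ, M.lintegral_p] at h
    exact h.symm
  lintegral_left := by
    have h1 : ∀ᵐ a ∂M.PA, M.pA a < ∞ :=
      (withDensity_absolutelyContinuous _ _).ae_le M.pA_lt_top
    have h2 : ∀ᵐ a ∂M.PA, M.pA a ≠ 0 := by
      rw [PA, ae_withDensity_iff M.measurable_pA]
      exact Filter.Eventually.of_forall fun a h => h
    filter_upwards [h1, h2] with a htop h0
    obtain ⟨q, hq⟩ : ∃ q : ℝ≥0, (q : ℝ≥0∞) = M.pA a := ⟨_, ENNReal.coe_toNNReal htop.ne⟩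
    have hq0 : q ≠ 0 := by rintro rfl; exact h0 hq.symm
    have : ∀ x, (M.dens x a : ℝ≥0∞) = M.p x a * (q : ℝ≥0∞)⁻¹ := fun x => by
      rw [dens, ← hq, ENNReal.toNNReal_coe, ENNReal.coe_div hq0, div_eq_mul_inv]
    simp only [this]
    rw [lintegral_mul_const _ (M.measurable_p_left a).coe_nnreal_ennreal]
    change M.pA a * _ = 1
    rw [← hq]
    exact ENNReal.mul_inv_cancel (by simpa using hq0) ENNReal.coe_ne_top

theorem Gam_eq (f : 𝒳 → ℝ) : M.Gam f = kernelAvg M.PX M.dens f := by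
  funext a
  simp only [Gam, kernelAvg, dens, NNReal.coe_div]
  rfl

variable {M}

/-- The pointwise form is needed, not just the almost sure one: it is evaluated at sample points. -/
theorem Dominated.GamStar_eq {x : 𝒳} (hx : M.Dominated x) (g : 𝒜 → ℝ) :
    M.GamStar g x = kernelAvg M.PA (fun a x => M.dens x a) g x := by
  have h1 := integral_withDensity_eq_integral_smul (μ := M.ν) (M.measurable_p_right x) g
  have h2 := integral_withDensity_eq_integral_smul (μ := M.PA)
    (M.measurable_dens_right x) g
  rw [← hx.withDensity_eq, h1] at h2
  simpa only [GamStar, kernelAvg, NNReal.smul_def, smul_eq_mul, mul_comm] using h2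

variable (M)

theorem GamStar_ae_eq (g : 𝒜 → ℝ) :
    M.GamStar g =ᵐ[M.PX] kernelAvg M.PA (fun a x => M.dens x a) g := by
  filter_upwards [M.ae_dominated] with x hx using hx.GamStar_eq g

theorem memLp_Gam {f : 𝒳 → ℝ} (hf : MemLp f 2 M.PX) : MemLp (M.Gam f) 2 M.PA := by
  rw [Gam_eq]; exact M.isBistochastic.memLp_kernelAvg hf

theorem memLp_GamStar {g : 𝒜 → ℝ} (hg : MemLp g 2 M.PA) : MemLp (M.GamStar g) 2 M.PX :=
  (M.isBistochastic.swap.memLp_kernelAvg hg).ae_eq (M.GamStar_ae_eq g).symm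

/-- `Γ` as an operator between `L²` spaces. -/
noncomputable def GamL : Lp ℝ 2 M.PX →L[ℝ] Lp ℝ 2 M.PA := M.isBistochastic.avgL

/-- `Γ*` as an operator between `L²` spaces. -/
noncomputable def GamStarL : Lp ℝ 2 M.PA →L[ℝ] Lp ℝ 2 M.PX := M.isBistochastic.swap.avgL

theorem GamL_toLp {f : 𝒳 → ℝ} (hf : MemLp f 2 M.PX) :
    M.GamL (hf.toLp f) = (M.memLp_Gam hf).toLp _ := by
  rw [GamL, M.isBistochastic.avgL_toLp hf]
  exact (MemLp.toLp_eq_toLp_iff _ _).2 (by rw [M.Gam_eq f])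

theorem GamStarL_toLp {g : 𝒜 → ℝ} (hg : MemLp g 2 M.PA) :
    M.GamStarL (hg.toLp g) = (M.memLp_GamStar hg).toLp _ := by
  rw [GamStarL, M.isBistochastic.swap.avgL_toLp hg]
  exact (MemLp.toLp_eq_toLp_iff _ _).2 (M.GamStar_ae_eq g).symm

theorem inner_GamL (f : Lp ℝ 2 M.PX) (g : Lp ℝ 2 M.PA) :
    inner ℝ (M.GamL f) g = inner ℝ f (M.GamStarL g) := M.isBistochastic.inner_avgL f g

theorem norm_GamL_le (f : Lp ℝ 2 M.PX) : ‖M.GamL f‖ ≤ ‖f‖ := M.isBistochastic.norm_avgL_le f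

theorem norm_GamStarL_le (g : Lp ℝ 2 M.PA) : ‖M.GamStarL g‖ ≤ ‖g‖ :=
  M.isBistochastic.swap.norm_avgL_le g

/-- `Γ*Γ` as an operator on `L²`. -/
noncomputable def GamSqL : Lp ℝ 2 M.PX →ₗ[ℝ] Lp ℝ 2 M.PX :=
  M.GamStarL.toLinearMap ∘ₗ M.GamL.toLinearMap

theorem GamSqL_apply (f : Lp ℝ 2 M.PX) : M.GamSqL f = M.GamStarL (M.GamL f) := rfl

theorem GamSqL_isSymmetric : M.GamSqL.IsSymmetric := fun f g => by
  rw [GamSqL_apply, GamSqL_apply, real_inner_comm, ← inner_GamL, ← inner_GamL, real_inner_comm]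

theorem inner_GamSqL_self (f : Lp ℝ 2 M.PX) : inner ℝ (M.GamSqL f) f = ‖M.GamL f‖ ^ 2 := by
  rw [real_inner_comm, GamSqL_apply, ← inner_GamL, real_inner_self_eq_norm_sq]

theorem inner_GamSqL_self_nonneg (f : Lp ℝ 2 M.PX) : 0 ≤ inner ℝ (M.GamSqL f) f := by
  rw [inner_GamSqL_self]; positivity

theorem inner_GamSqL_self_le (f : Lp ℝ 2 M.PX) : inner ℝ (M.GamSqL f) f ≤ ‖f‖ ^ 2 := by
  rw [inner_GamSqL_self]; gcongr; exact M.norm_GamL_le f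

theorem eig_eq (n : ℕ) : M.eig n = sortedEig M.GamSqL n := by
  refine sortedEigenvalue_eq_sortedEig (fun f hf => ?_) n
  rw [GamSqL_apply, GamL_toLp, GamStarL_toLp]
  exact MemLp.coeFn_toLp _

theorem eig_antitone : Antitone M.eig := by
  rw [show M.eig = sortedEig M.GamSqL from funext M.eig_eq]
  exact sortedEig_antitone M.inner_GamSqL_self_nonneg M.inner_GamSqL_self_le

end Augmentation

/-! ### `L²` pairings and integration against the empirical measure. -/

theorem norm_toLp_sq {α : Type*} [MeasurableSpace α] {μ : Measure α} {f : α → ℝ}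
    (hf : MemLp f 2 μ) : ‖hf.toLp f‖ ^ 2 = ∫ z, f z ^ 2 ∂μ := by
  rw [← real_inner_self_eq_norm_sq, inner_toLp_eq]
  simp only [pow_two]

theorem abs_integral_mul_le {α : Type*} [MeasurableSpace α] {μ : Measure α} {f g : α → ℝ}
    (hf : MemLp f 2 μ) (hg : MemLp g 2 μ) :
    |∫ z, f z * g z ∂μ| ≤ Real.sqrt (∫ z, f z ^ 2 ∂μ) * Real.sqrt (∫ z, g z ^ 2 ∂μ) := by
  rw [← inner_toLp_eq hf hg, ← norm_toLp_sq hf, ← norm_toLp_sq hg,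
    Real.sqrt_sq (norm_nonneg _), Real.sqrt_sq (norm_nonneg _)]
  exact abs_real_inner_le_norm _ _

instance isProbabilityMeasure_empMeasure {𝒳 : Type*} [MeasurableSpace 𝒳] {N : ℕ} [NeZero N]
    (x : Fin N → 𝒳) : IsProbabilityMeasure (empMeasure x) := by
  constructor
  rw [empMeasure, Measure.smul_apply, Measure.finsetSum_apply]
  simp only [measure_univ, Finset.sum_const, Finset.card_univ, Fintype.card_fin, nsmul_eq_mul,
    mul_one, smul_eq_mul]
  exact ENNReal.inv_mul_cancel (by simpa using NeZero.ne N) (by simp)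

section EmpMeasure

variable {𝒳 : Type*} [MeasurableSpace 𝒳] [MeasurableSingletonClass 𝒳] {N : ℕ} (x : Fin N → 𝒳)

theorem integral_empMeasure (h : 𝒳 → ℝ) :
    ∫ z, h z ∂(empMeasure x) = (N : ℝ)⁻¹ * ∑ k, h (x k) := by
  rw [empMeasure, integral_smul_measure, integral_finsetSum_measure]
  · simp
  · exact fun k _ => integrable_dirac (by simp)

theorem lintegral_empMeasure (h : 𝒳 → ℝ≥0∞) :
    ∫⁻ z, h z ∂(empMeasure x) = (N : ℝ≥0∞)⁻¹ * ∑ k, h (x k) := by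
  rw [empMeasure, lintegral_smul_measure, lintegral_finsetSum_measure]
  simp

theorem ae_empMeasure_iff [NeZero N] {q : 𝒳 → Prop} :
    (∀ᵐ z ∂(empMeasure x), q z) ↔ ∀ k, q (x k) := by
  rw [ae_iff, empMeasure, Measure.smul_apply, Measure.finsetSum_apply]
  simp [Measure.dirac_apply]

/-- Sample points have positive mass, so a class has well-defined values there and is determined by
them. -/
instance finiteDimensional_Lp_empMeasure [NeZero N] :
    FiniteDimensional ℝ (Lp ℝ 2 (empMeasure x)) := by
  let L : Lp ℝ 2 (empMeasure x) →ₗ[ℝ] (Fin N → ℝ) :=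
    { toFun := fun f k => f (x k)
      map_add' := fun f g => funext fun k => (ae_empMeasure_iff x).1 (Lp.coeFn_add f g) k
      map_smul' := fun c f => funext fun k => (ae_empMeasure_iff x).1 (Lp.coeFn_smul c f) k }
  refine FiniteDimensional.of_injective L fun f g hfg => ?_
  exact Lp.ext ((ae_empMeasure_iff x).2 fun k => congrFun hfg k)

end EmpMeasure

/-! ### The empirical objects as population objects of the model `emp`. -/

namespace Augmentation

variable {𝒳 𝒜 : Type*} [MeasurableSpace 𝒳] [MeasurableSpace 𝒜] (M : Augmentation 𝒳 𝒜)

/-- The augmentation model in which the data distribution is replaced by the empirical measure. -/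
noncomputable def emp {N : ℕ} [NeZero N] (x : Fin N → 𝒳) : Augmentation 𝒳 𝒜 where
  PX := empMeasure x
  isProb := inferInstance
  ν := M.ν
  sigmaFinite := M.sigmaFinite
  p := M.p
  measurable_p := M.measurable_p
  lintegral_p := M.lintegral_p

section Emp

variable [MeasurableSingletonClass 𝒳] {N : ℕ} [NeZero N] (x : Fin N → 𝒳)

theorem emp_pA (a : 𝒜) : (M.emp x).pA a = M.empDensity x a := by
  rw [pA, empDensity]
  change ∫⁻ z, (M.p z a : ℝ≥0∞) ∂(empMeasure x) = _
  rw [lintegral_empMeasure, ENNReal.coe_mul, ENNReal.coe_inv (by simpa using NeZero.ne N),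
    ENNReal.ofNNReal_finsetSum]
  simp

theorem emp_PA : (M.emp x).PA = M.empPA x := by
  rw [PA, show (M.emp x).pA = _ from funext (M.emp_pA x)]
  rfl

theorem emp_Gam (f : 𝒳 → ℝ) : (M.emp x).Gam f = M.empGam x f := by
  funext a
  rw [Gam, empGam, emp_pA]
  change ∫ z, f z * ((M.p z a : ℝ) / _) ∂(empMeasure x) = _
  rw [integral_empMeasure]
  simp [mul_div_assoc]

theorem emp_eig : (M.emp x).eig = M.empEig x := by
  funext n
  rw [eig, empEig]
  simp only [emp_Gam]
  rfl

variable {M x}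

/-- Where `p(a)` vanishes, so do, almost everywhere, all the densities that the empirical one
averages. Sup bounds under `PA` thereby hold under `empPA`. -/
theorem empPA_absolutelyContinuous (hx : ∀ k, M.Dominated (x k)) : M.empPA x ≪ M.PA := by
  intro s hs
  have hmd : Measurable fun a => (M.empDensity x a : ℝ≥0∞) := by
    simp only [← emp_pA]; exact (M.emp x).measurable_pA
  rw [measure_eq_zero_iff_ae_notMem] at hs ⊢
  rw [PA, ae_withDensity_iff M.measurable_pA] at hs
  rw [empPA, ae_withDensity_iff hmd]
  filter_upwards [hs, ae_all_iff.2 hx] with a h1 h2 h3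
  refine h1 fun h0 => h3 ?_
  simp [empDensity, fun k => h2 k h0]

end Emp

/-! ### Regular data points and the concentration event. -/

/-- A data point at which the kernel does not exceed its essential supremum. -/
def Regular (x : 𝒳) : Prop := M.KX x x ≤ M.kappaSq

theorem measurableSet_regular : MeasurableSet {x | M.Regular x} := by
  have : Measurable fun x => M.KX x x := by
    have h : Measurable fun z : 𝒳 × 𝒜 => (M.p z.1 z.2 : ℝ≥0∞) * (M.p z.1 z.2 : ℝ≥0∞) / M.pA z.2 :=
      (M.measurable_p.coe_nnreal_ennreal.mul M.measurable_p.coe_nnreal_ennreal).div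
        (M.measurable_pA.comp measurable_snd)
    exact h.lintegral_prod_right'
  exact measurableSet_le this measurable_const

theorem ae_regular : ∀ᵐ x ∂M.PX, M.Regular x := ENNReal.ae_le_essSup _

theorem kappa_nonneg : 0 ≤ M.kappa := Real.sqrt_nonneg _

variable {M}

/-- A positive number divided by `p(a) = 0` is `∞`, which a finite `K_X(x,x)` allows only on a null
set. -/
theorem Regular.dominated (hκ : M.kappaSq ≠ ∞) {x : 𝒳} (hx : M.Regular x) : M.Dominated x := by
  have hm : Measurable fun a => (M.p x a : ℝ≥0∞) * (M.p x a : ℝ≥0∞) / M.pA a :=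
    ((M.measurable_p_right x).coe_nnreal_ennreal.mul
      (M.measurable_p_right x).coe_nnreal_ennreal).div M.measurable_pA
  filter_upwards [ae_lt_top hm (ne_top_of_le_ne_top hκ hx)] with a ha h0
  by_contra hp
  rw [h0, ENNReal.div_zero (by simpa using hp)] at ha
  exact lt_irrefl _ ha

theorem Regular.lintegral_dens_sq_le (hκ : M.kappaSq ≠ ∞) {x : 𝒳} (hx : M.Regular x) :
    ∫⁻ a, (M.dens x a : ℝ≥0∞) ^ 2 ∂M.PA ≤ M.kappaSq := by
  refine le_trans (le_of_eq ?_) hx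
  rw [PA, lintegral_withDensity_eq_lintegral_mul _ M.measurable_pA
    ((M.measurable_dens_right x).coe_nnreal_ennreal.pow_const 2), KX]
  refine lintegral_congr_ae ?_
  filter_upwards [(hx.dominated hκ).pA_mul_dens, hx.dominated hκ, M.pA_lt_top] with a h1 h2 htop
  simp only [Pi.mul_apply]
  rw [pow_two, ← mul_assoc, h1, mul_div_assoc]
  congr 1
  by_cases h0 : M.pA a = 0
  · simp [dens, h2 h0]
  · rw [← h1, mul_comm, ENNReal.mul_div_cancel_right h0 htop.ne]

theorem Regular.memLp_dens (hκ : M.kappaSq ≠ ∞) {x : 𝒳} (hx : M.Regular x) :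
    MemLp (fun a => (M.dens x a : ℝ)) 2 M.PA := by
  have hm : AEStronglyMeasurable (fun a => (M.dens x a : ℝ)) M.PA :=
    (M.measurable_dens_right x).coe_nnreal_real.aestronglyMeasurable
  refine ⟨hm, ?_⟩
  have := eLpNorm_two_sq M.PA (fun a => (M.dens x a : ℝ))
  simp only [Real.enorm_of_nonneg (NNReal.coe_nonneg _), ENNReal.ofReal_coe_nnreal] at this
  have h2 : eLpNorm (fun a => (M.dens x a : ℝ)) 2 M.PA ^ 2 < ∞ := by
    rw [this]; exact (hx.lintegral_dens_sq_le hκ).trans_lt hκ.lt_top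
  exact (ENNReal.pow_lt_top_iff.1 h2).resolve_right two_ne_zero

theorem Regular.integral_dens_sq_le (hκ : M.kappaSq ≠ ∞) {x : 𝒳} (hx : M.Regular x) :
    ∫ a, (M.dens x a : ℝ) ^ 2 ∂M.PA ≤ M.kappa ^ 2 := by
  rw [kappa, Real.sq_sqrt ENNReal.toReal_nonneg, integral_eq_lintegral_of_nonneg_ae
    (Filter.Eventually.of_forall fun a => by positivity)
    ((M.measurable_dens_right x).coe_nnreal_real.pow_const 2).aestronglyMeasurable]
  refine ENNReal.toReal_mono hκ (le_trans (le_of_eq ?_) (hx.lintegral_dens_sq_le hκ))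
  refine lintegral_congr fun a => ?_
  rw [ENNReal.ofReal_pow (NNReal.coe_nonneg _), ENNReal.ofReal_coe_nnreal]

/-- Cauchy–Schwarz against `dens x`, whose squared norm is at most `κ²`. All sup bounds on
eigenfunctions come from here. -/
theorem Regular.abs_GamStar_le (hκ : M.kappaSq ≠ ∞) {x : 𝒳} (hx : M.Regular x) {g : 𝒜 → ℝ}
    (hg : MemLp g 2 M.PA) : |M.GamStar g x| ≤ M.kappa * Real.sqrt (∫ a, g a ^ 2 ∂M.PA) := by
  rw [(hx.dominated hκ).GamStar_eq, kernelAvg, mul_comm]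
  refine (abs_integral_mul_le hg (hx.memLp_dens hκ)).trans ?_
  gcongr
  exact Real.sqrt_le_iff.2 ⟨M.kappa_nonneg, hx.integral_dens_sq_le hκ⟩

theorem Regular.GamStar_linear (hκ : M.kappaSq ≠ ∞) {x : 𝒳} (hx : M.Regular x) {ι : Type*}
    (s : Finset ι) (c : ι → ℝ) {g : ι → 𝒜 → ℝ} (hg : ∀ i, MemLp (g i) 2 M.PA) :
    M.GamStar (fun a => ∑ i ∈ s, c i * g i a) x = ∑ i ∈ s, c i * M.GamStar (g i) x := by
  simp only [(hx.dominated hκ).GamStar_eq, kernelAvg, Finset.sum_mul]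
  rw [integral_finsetSum]
  · refine Finset.sum_congr rfl fun i _ => ?_
    simp only [mul_assoc]
    rw [integral_const_mul]
  · intro i _
    simp only [mul_assoc]
    exact ((hg i).integrable_mul (hx.memLp_dens hκ)).const_mul _

/-- A sample on which the empirical averages of `Γ*u` and of `(Γ*u)²` are uniformly close to their
means. -/
structure GoodSample (M : Augmentation 𝒳 𝒜) {N : ℕ} (x : Fin N → 𝒳) (r : ℝ) : Prop where
  regular : ∀ k, M.Regular (x k)
  mean_le : ∀ u, MemLp u 2 M.PA →
    |(N : ℝ)⁻¹ * ∑ k, M.GamStar u (x k) - ∫ z, M.GamStar u z ∂M.PX|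
      ≤ M.kappa * r * Real.sqrt (∫ a, u a ^ 2 ∂M.PA)
  mean_sq_le : ∀ u, MemLp u 2 M.PA →
    |(N : ℝ)⁻¹ * ∑ k, M.GamStar u (x k) ^ 2 - ∫ z, M.GamStar u z ^ 2 ∂M.PX|
      ≤ M.kappa ^ 2 * r * ∫ a, u a ^ 2 ∂M.PA

variable (M)

theorem exists_goodSample_event (hκ : M.kappaSq ≠ ∞) {N : ℕ} (hN : 1 ≤ N) {δ : ℝ} (hδ : 0 < δ)
    (hδ1 : δ ≤ 1) :
    ∃ S : Set (Fin N → 𝒳), MeasurableSet S ∧ (Measure.pi fun _ : Fin N => M.PX).real Sᶜ ≤ δ ∧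
      ∀ x ∈ S, M.GoodSample x ((1 + Real.sqrt (2 * Real.log (2 / δ))) / Real.sqrt N) := by
  classical
  let R : Set 𝒳 := {x | M.Regular x}
  have hR : MeasurableSet R := M.measurableSet_regular
  -- The density is set to zero off the regular points, so that the bound by `κ` holds at every `x`.
  let h : 𝒳 → 𝒜 → ℝ := fun x a => R.indicator (fun x => (M.dens x a : ℝ)) x
  have hon : ∀ {x}, x ∈ R → h x = fun a => (M.dens x a : ℝ) := fun hx => by
    funext a; simp [h, hx]
  have hoff : ∀ {x}, x ∉ R → h x = fun _ => 0 := fun hx => by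
    funext a; simp [h, hx]
  have hm : Measurable fun z : 𝒳 × 𝒜 => h z.1 z.2 := by
    have : (fun z : 𝒳 × 𝒜 => h z.1 z.2)
        = (Prod.fst ⁻¹' R).indicator fun z : 𝒳 × 𝒜 => (M.dens z.1 z.2 : ℝ) := rfl
    rw [this]
    exact M.measurable_dens.coe_nnreal_real.indicator (measurable_fst hR)
  have hL : ∀ x, MemLp (h x) 2 M.PA := fun x => by
    by_cases hx : x ∈ R
    · rw [hon hx]; exact Regular.memLp_dens hκ hx
    · rw [hoff hx]; exact MemLp.zero'
  have hB : ∀ x, ∫ a, h x a ^ 2 ∂M.PA ≤ M.kappa ^ 2 := fun x => by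
    by_cases hx : x ∈ R
    · rw [hon hx]; exact Regular.integral_dens_sq_le hκ hx
    · rw [hoff hx]; simp [sq_nonneg]
  -- The tensor square makes `(Γ*u)²` linear in `u ⊗ u`, so the same concentration result applies
  -- with the bound `κ²`.
  let h' : 𝒳 → 𝒜 × 𝒜 → ℝ := fun x z => h x z.1 * h x z.2
  have hm' : Measurable fun z : 𝒳 × (𝒜 × 𝒜) => h' z.1 z.2 :=
    (hm.comp (by fun_prop : Measurable fun z : 𝒳 × (𝒜 × 𝒜) => (z.1, z.2.1))).mul
      (hm.comp (by fun_prop : Measurable fun z : 𝒳 × (𝒜 × 𝒜) => (z.1, z.2.2)))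
  have htensor : ∀ u : 𝒜 → ℝ, MemLp u 2 M.PA →
      MemLp (fun z : 𝒜 × 𝒜 => u z.1 * u z.2) 2 (M.PA.prod M.PA) := fun u hu => by
    refine (memLp_two_iff_integrable_sq (hu.1.comp_fst.mul hu.1.comp_snd)).2 ?_
    simp only [Pi.mul_apply, mul_pow]
    exact hu.integrable_sq.mul_prod hu.integrable_sq
  have htensor_sq : ∀ u : 𝒜 → ℝ, ∫ z : 𝒜 × 𝒜, (u z.1 * u z.2) ^ 2 ∂(M.PA.prod M.PA)
      = (∫ a, u a ^ 2 ∂M.PA) ^ 2 := fun u => by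
    simp only [mul_pow]
    rw [integral_prod_mul (fun a => u a ^ 2) (fun a => u a ^ 2), ← pow_two]
  have hB' : ∀ x, ∫ z, h' x z ^ 2 ∂(M.PA.prod M.PA) ≤ (M.kappa ^ 2) ^ 2 := fun x => by
    rw [htensor_sq (h x)]
    exact pow_le_pow_left₀ (integral_nonneg fun a => sq_nonneg _) (hB x) 2
  obtain ⟨S₁, hS₁, hS₁δ, hS₁u⟩ := exists_kernel_concentration_event M.PX M.PA hm hL
    M.kappa_nonneg hB hN (half_pos hδ) (by linarith)
  obtain ⟨S₂, hS₂, hS₂δ, hS₂u⟩ := exists_kernel_concentration_event M.PX (M.PA.prod M.PA) hm'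
    (fun x => htensor _ (hL x)) (sq_nonneg M.kappa) hB' hN (half_pos hδ) (by linarith)
  -- Each of the two events is allotted failure probability `δ/2`.
  have hlog : 1 / (δ / 2) = 2 / δ := by field_simp
  rw [hlog] at hS₁u hS₂u
  let S₀ : Set (Fin N → 𝒳) := Set.univ.pi fun _ => R
  have hS₀ : MeasurableSet S₀ := MeasurableSet.univ_pi fun _ => hR
  have hS₀0 : (Measure.pi fun _ : Fin N => M.PX) S₀ᶜ = 0 := by
    rw [prob_compl_eq_zero_iff hS₀, Measure.pi_pi]
    have : M.PX R = 1 := (prob_compl_eq_zero_iff hR).1 M.ae_regular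
    simp [this]
  have hGS : ∀ {x}, x ∈ R → ∀ u, M.GamStar u x = ∫ a, u a * h x a ∂M.PA := fun {x} hx u => by
    rw [(Regular.dominated hκ hx).GamStar_eq, hon hx]; rfl
  have hGS2 : ∀ {x}, x ∈ R → ∀ u, M.GamStar u x ^ 2
      = ∫ z : 𝒜 × 𝒜, (u z.1 * u z.2) * h' x z ∂(M.PA.prod M.PA) := fun {x} hx u => by
    rw [hGS hx, pow_two, ← integral_prod_mul]
    refine integral_congr_ae (Filter.Eventually.of_forall fun z => ?_)
    simp only [h']; ring
  refine ⟨S₀ ∩ (S₁ ∩ S₂), hS₀.inter (hS₁.inter hS₂), ?_, ?_⟩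
  · rw [Set.compl_inter, Set.compl_inter]
    calc _ ≤ _ := measureReal_union_le _ _
      _ ≤ 0 + (δ / 2 + δ / 2) := by
        gcongr
        · rw [measureReal_def, hS₀0]; simp
        · exact (measureReal_union_le _ _).trans (add_le_add hS₁δ hS₂δ)
      _ = δ := by ring
  rintro x ⟨hx0, hx1, hx2⟩
  have hxR : ∀ k, x k ∈ R := fun k => hx0 k (Set.mem_univ k)
  refine ⟨hxR, fun u hu => ?_, fun u hu => ?_⟩
  · have := hS₁u x hx1 u hu
    have e : ∫ z, M.GamStar u z ∂M.PX = ∫ z, ∫ a, u a * h z a ∂M.PA ∂M.PX := by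
      refine integral_congr_ae ?_
      filter_upwards [M.ae_regular] with z hz using hGS hz u
    simp only [hGS (hxR _), e]
    exact this
  · have := hS₂u x hx2 _ (htensor u hu)
    rw [htensor_sq, Real.sqrt_sq (integral_nonneg fun a => sq_nonneg _)] at this
    have e : ∫ z, M.GamStar u z ^ 2 ∂M.PX
        = ∫ z, ∫ w : 𝒜 × 𝒜, (u w.1 * u w.2) * h' z w ∂(M.PA.prod M.PA) ∂M.PX := by
      refine integral_congr_ae ?_
      filter_upwards [M.ae_regular] with z hz using hGS2 hz u
    simp only [hGS2 (hxR _), e]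
    exact this

end Augmentation

/-! ### Diagonalization and Gram matrices. -/

/-- Diagonalization of a real symmetric matrix in an orthonormal basis. -/
theorem Matrix.IsHermitian.exists_diagonalization {d : ℕ} {A : Matrix (Fin d) (Fin d) ℝ}
    (hA : A.IsHermitian) :
    ∃ (b : Fin d → Fin d → ℝ) (D : Fin d → ℝ),
      (∀ i j, b i ⬝ᵥ b j = if i = j then 1 else 0) ∧ (∀ i, A.mulVec (b i) = D i • b i) ∧
      spectrum ℝ A = Set.range D ∧ A.det = ∏ i, D i ∧
      (∀ B : Matrix (Fin d) (Fin d) ℝ, B.trace = ∑ i, b i ⬝ᵥ B.mulVec (b i)) ∧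
      (∀ v, v ⬝ᵥ A.mulVec v = ∑ i, D i * (b i ⬝ᵥ v) ^ 2) ∧
      ∀ v, v ⬝ᵥ v = ∑ i, (b i ⬝ᵥ v) ^ 2 := by
  let b : Fin d → Fin d → ℝ := fun i => hA.eigenvectorBasis i
  have hb : ∀ i j, b i ⬝ᵥ b j = if i = j then 1 else 0 := by
    intro i j
    have := orthonormal_iff_ite.1 hA.eigenvectorBasis.orthonormal i j
    rw [← this, PiLp.inner_apply]
    simp [dotProduct, b, mul_comm]
  let V : Matrix (Fin d) (Fin d) ℝ := Matrix.of b
  have hV : V * V.transpose = 1 := by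
    ext i j
    rw [Matrix.mul_apply, Matrix.one_apply, ← hb]
    rfl
  have hV' : V.transpose * V = 1 := mul_eq_one_comm.1 hV
  have hVv : ∀ v, V.mulVec v = fun i => b i ⬝ᵥ v := fun v => rfl
  have hnorm : ∀ u v, u ⬝ᵥ v = ∑ i, (b i ⬝ᵥ u) * (b i ⬝ᵥ v) := by
    intro u v
    have : V.mulVec u ⬝ᵥ V.mulVec v = u ⬝ᵥ v := by
      rw [Matrix.dotProduct_mulVec, Matrix.vecMul_mulVec, hV', Matrix.vecMul_one]
    rw [← this, hVv, hVv]; rfl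
  have hAb : ∀ i, A.mulVec (b i) = hA.eigenvalues i • b i := fun i =>
    hA.mulVec_eigenvectorBasis i
  refine ⟨b, hA.eigenvalues, hb, hAb, hA.spectrum_real_eq_range_eigenvalues, ?_, fun B => ?_,
    fun v => ?_, fun v => ?_⟩
  · simpa using hA.det_eq_prod_eigenvalues
  · have : B.trace = (V * B * V.transpose).trace := by
      rw [Matrix.trace_mul_comm, ← Matrix.mul_assoc, hV', Matrix.one_mul]
    rw [this, Matrix.trace]
    refine Finset.sum_congr rfl fun i _ => ?_
    rw [Matrix.diag_apply, Matrix.mul_assoc, Matrix.mul_apply]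
    rfl
  · rw [hnorm]
    refine Finset.sum_congr rfl fun i _ => ?_
    have hsymm : b i ⬝ᵥ A.mulVec v = A.mulVec (b i) ⬝ᵥ v := by
      rw [Matrix.dotProduct_mulVec, ← Matrix.mulVec_transpose]
      congr 2
    rw [hsymm, hAb, smul_dotProduct, smul_eq_mul]
    ring
  · rw [hnorm]
    exact Finset.sum_congr rfl fun i _ => (pow_two _).symm

theorem gramL2_isHermitian {α : Type*} [MeasurableSpace α] {d : ℕ} (μ : Measure α)
    (f : Fin d → α → ℝ) : (gramL2 μ f).IsHermitian := by
  ext i j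
  simp [gramL2, mul_comm]

/-- Inner products of linear combinations in terms of the Gram matrix. -/
theorem integral_sum_mul_sum {α : Type*} [MeasurableSpace α] {d : ℕ} {μ : Measure α}
    {f : Fin d → α → ℝ} (hf : ∀ i, MemLp (f i) 2 μ) (c c' : Fin d → ℝ) :
    ∫ z, (∑ i, c i * f i z) * (∑ j, c' j * f j z) ∂μ = c ⬝ᵥ (gramL2 μ f).mulVec c' := by
  simp only [Finset.sum_mul_sum]
  have hi : ∀ i j, Integrable (fun z => c i * f i z * (c' j * f j z)) μ := fun i j =>
    (((hf i).const_mul (c i)).integrable_mul ((hf j).const_mul (c' j)))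
  rw [integral_finsetSum _ fun i _ => integrable_finsetSum _ fun j _ => hi i j]
  refine Finset.sum_congr rfl fun i _ => ?_
  rw [integral_finsetSum _ fun j _ => hi i j, Matrix.mulVec, dotProduct, Finset.mul_sum]
  refine Finset.sum_congr rfl fun j _ => ?_
  rw [gramL2, Matrix.of_apply, ← integral_mul_const, ← integral_const_mul]
  exact integral_congr_ae (Filter.Eventually.of_forall fun z => by simp only; ring)

theorem integral_sum_sq {α : Type*} [MeasurableSpace α] {d : ℕ} {μ : Measure α}
    {f : Fin d → α → ℝ} (hf : ∀ i, MemLp (f i) 2 μ) (c : Fin d → ℝ) :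
    ∫ z, (∑ i, c i * f i z) ^ 2 ∂μ = c ⬝ᵥ (gramL2 μ f).mulVec c := by
  rw [← integral_sum_mul_sum hf]
  simp only [pow_two]

/-! ### Rayleigh quotients under population and sample. -/

namespace Augmentation

variable {𝒳 𝒜 : Type*} [MeasurableSpace 𝒳] [MeasurableSpace 𝒜] (M : Augmentation 𝒳 𝒜)

/-- Total expectation. In the model `emp` it turns the empirical norm of `u` into an empirical mean
of `Γ*(u²)`. -/
theorem integral_PA_eq {v : 𝒜 → ℝ} (hv : MemLp v 2 M.PA) :
    ∫ a, v a ∂M.PA = ∫ x, M.GamStar v x ∂M.PX := by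
  have h := M.isBistochastic.integral_kernelAvg_mul (memLp_const (1 : ℝ)) hv
  rw [integral_congr_ae (M.GamStar_ae_eq v)]
  simp only [one_mul] at h
  rw [← h]
  refine integral_congr_ae ?_
  filter_upwards [M.isBistochastic.lintegral_left] with a ha
  rw [kernelAvg_one (M.isBistochastic.measurable_left a) ha, one_mul]

theorem integral_GamStar_sq_eq {g : 𝒜 → ℝ} (hg : MemLp g 2 M.PA) :
    ∫ x, M.GamStar g x ^ 2 ∂M.PX = ‖M.GamStarL (hg.toLp g)‖ ^ 2 := by
  rw [GamStarL_toLp, norm_toLp_sq]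

theorem integral_GamStar_sq_le {g : 𝒜 → ℝ} (hg : MemLp g 2 M.PA) :
    ∫ x, M.GamStar g x ^ 2 ∂M.PX ≤ ∫ a, g a ^ 2 ∂M.PA := by
  rw [integral_GamStar_sq_eq M hg, ← norm_toLp_sq hg]
  gcongr
  exact M.norm_GamStarL_le _

theorem ae_abs_GamL_GamStarL_le (hκ : M.kappaSq ≠ ∞) (w : Lp ℝ 2 M.PA) :
    ∀ᵐ a ∂M.PA, |M.GamL (M.GamStarL w) a| ≤ M.kappa * ‖w‖ := by
  have hw : ‖w‖ = Real.sqrt (∫ a, w a ^ 2 ∂M.PA) := by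
    rw [← norm_toLp_sq (Lp.memLp w), Lp.toLp_coeFn, Real.sqrt_sq (norm_nonneg _)]
  have h1 : ∀ᵐ x ∂M.PX, |M.GamStarL w x| ≤ M.kappa * ‖w‖ := by
    have h2 := (M.memLp_GamStar (Lp.memLp w)).coeFn_toLp
    rw [← GamStarL_toLp M (Lp.memLp w), Lp.toLp_coeFn] at h2
    filter_upwards [h2, M.ae_regular] with x hx hreg
    rw [hx, hw]
    exact Regular.abs_GamStar_le hκ hreg (Lp.memLp w)
  filter_upwards [M.isBistochastic.coeFn_avgL (M.GamStarL w), M.isBistochastic.lintegral_left]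
    with a ha h1a
  rw [GamL, ha]
  exact abs_kernelAvg_le (M.isBistochastic.measurable_left a) h1a h1

theorem integral_GamStar_sum_sq (hκ : M.kappaSq ≠ ∞) {d : ℕ} {g : Fin d → 𝒜 → ℝ}
    (hg : ∀ i, MemLp (g i) 2 M.PA) (c : Fin d → ℝ) :
    ∫ x, M.GamStar (fun a => ∑ i, c i * g i a) x ^ 2 ∂M.PX = c ⬝ᵥ (M.F g).mulVec c := by
  rw [F, ← integral_sum_sq fun i => M.memLp_GamStar (hg i)]
  refine integral_congr_ae ?_
  filter_upwards [M.ae_regular] with x hx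
  rw [Regular.GamStar_linear hκ hx Finset.univ c hg]

variable {M} [MeasurableSingletonClass 𝒳] {N : ℕ} [NeZero N] {x : Fin N → 𝒳}

/-- No measurability of `f` is needed: `f` agrees almost everywhere with its restriction to the
finite set of sample points. -/
theorem memLp_empMeasure (f : 𝒳 → ℝ) : MemLp f 2 (empMeasure x) := by
  have hsm : AEStronglyMeasurable f (empMeasure x) := by
    have hfin : (Set.range x).Finite := Set.finite_range x
    refine ⟨fun z => (Set.range x).indicator f z, Measurable.stronglyMeasurable fun t ht => ?_, ?_⟩
    · change MeasurableSet ((Set.range x).indicator f ⁻¹' t)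
      rw [Set.indicator_preimage]
      exact (hfin.subset Set.inter_subset_right).measurableSet.union
        ((measurable_const ht).diff hfin.measurableSet)
    · exact (ae_empMeasure_iff x).2 fun k => by simp
  refine MemLp.of_bound hsm (∑ k, |f (x k)|) ((ae_empMeasure_iff x).2 fun k => ?_)
  exact Finset.single_le_sum (f := fun k => |f (x k)|) (fun k _ => abs_nonneg _)
    (Finset.mem_univ k)

theorem GoodSample.emp_PA_absolutelyContinuous (hκ : M.kappaSq ≠ ∞) {r : ℝ}
    (h : M.GoodSample x r) : (M.emp x).PA ≪ M.PA := by
  rw [emp_PA]; exact empPA_absolutelyContinuous fun k => (h.regular k).dominated hκ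

theorem GoodSample.memLp_emp_PA (hκ : M.kappaSq ≠ ∞) {r : ℝ} (h : M.GoodSample x r)
    {u : 𝒜 → ℝ} (hu : AEStronglyMeasurable u M.PA) {C : ℝ} (hC : ∀ᵐ a ∂M.PA, |u a| ≤ C) :
    MemLp u 2 (M.emp x).PA :=
  MemLp.of_bound (hu.mono_ac (h.emp_PA_absolutelyContinuous hκ)) C
    ((h.emp_PA_absolutelyContinuous hκ).ae_le hC)

theorem GoodSample.integral_GamStar_sum_sq_emp (hκ : M.kappaSq ≠ ∞) {r : ℝ} (h : M.GoodSample x r)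
    {d : ℕ} {g : Fin d → 𝒜 → ℝ} (hg : ∀ i, MemLp (g i) 2 M.PA) (c : Fin d → ℝ) :
    ∫ z, M.GamStar (fun a => ∑ i, c i * g i a) z ^ 2 ∂(M.emp x).PX
      = c ⬝ᵥ (M.empF x g).mulVec c := by
  rw [empF, ← integral_sum_sq fun i => memLp_empMeasure _]
  refine integral_congr_ae ((ae_empMeasure_iff x).2 fun k => ?_)
  simp only
  rw [Regular.GamStar_linear hκ (h.regular k) Finset.univ c hg]

/-- On a good sample, the Rayleigh quotient of a bounded function changes little when the population
is replaced by the sample. -/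
theorem GoodSample.abs_rayleigh_sub_le (hκ : M.kappaSq ≠ ∞) {r : ℝ} (hr : 0 ≤ r)
    (h : M.GoodSample x r) {u : 𝒜 → ℝ} (hu : MemLp u 2 M.PA) (h1 : ∫ a, u a ^ 2 ∂M.PA = 1)
    {C : ℝ} (hC0 : 0 ≤ C) (hC : ∀ᵐ a ∂M.PA, |u a| ≤ C) :
    |(∫ z, M.GamStar u z ^ 2 ∂(M.emp x).PX) / (∫ a, u a ^ 2 ∂(M.emp x).PA)
        - ∫ z, M.GamStar u z ^ 2 ∂M.PX| ≤ r * (C * M.kappa + M.kappa ^ 2) := by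
  set f := ∫ z, M.GamStar u z ^ 2 ∂M.PX
  set f' := ∫ z, M.GamStar u z ^ 2 ∂(M.emp x).PX with hf'
  set g := ∫ a, u a ^ 2 ∂(M.emp x).PA with hg
  have hκ0 := M.kappa_nonneg
  have hsq : ∀ᵐ a ∂M.PA, |u a ^ 2| ≤ C ^ 2 := by
    filter_upwards [hC] with a ha
    rw [abs_pow]; gcongr
  have husm : AEStronglyMeasurable (fun a => u a ^ 2) M.PA := hu.1.pow 2
  have hu2 : MemLp (fun a => u a ^ 2) 2 M.PA := MemLp.of_bound husm (C ^ 2) hsq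
  -- `Γ*` is a contraction for the empirical model too, so the quotient is at most `1`.
  have hgf : f' ≤ g := (M.emp x).integral_GamStar_sq_le (h.memLp_emp_PA hκ hu.1 hC)
  have hf0 : 0 ≤ f' := integral_nonneg fun z => sq_nonneg _
  have hff : |f' - f| ≤ M.kappa ^ 2 * r := by
    have := h.mean_sq_le u hu
    rw [h1, mul_one, ← integral_empMeasure x fun z => M.GamStar u z ^ 2] at this
    exact this
  have hgg : |g - 1| ≤ M.kappa * r * C := by
    have h2 := h.mean_le _ hu2
    have h3 : g = ∫ z, M.GamStar (fun a => u a ^ 2) z ∂(M.emp x).PX :=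
      (M.emp x).integral_PA_eq (h.memLp_emp_PA hκ husm hsq)
    rw [← integral_PA_eq M hu2, ← integral_empMeasure, h1] at h2
    rw [h3]
    refine h2.trans ?_
    gcongr
    refine Real.sqrt_le_iff.2 ⟨hC0, ?_⟩
    calc ∫ a, (u a ^ 2) ^ 2 ∂M.PA ≤ ∫ a, C ^ 2 * u a ^ 2 ∂M.PA := by
          refine integral_mono_ae hu2.integrable_sq (hu.integrable_sq.const_mul _) ?_
          filter_upwards [hsq] with a ha
          rw [pow_two (u a ^ 2)]
          exact mul_le_mul_of_nonneg_right ((le_abs_self _).trans ha) (sq_nonneg _)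
      _ = C ^ 2 := by rw [integral_const_mul, h1, mul_one]
  have hg0 : 0 ≤ g := hf0.trans hgf
  have hq : |f' / g| ≤ 1 := by
    rw [abs_of_nonneg (div_nonneg hf0 hg0)]
    exact div_le_one_of_le₀ hgf hg0
  -- The denominator's error is multiplied by a quotient at most `1`, so no lower bound on `g` is
  -- required; if `g = 0`, then `f' = 0` and `0/0 = 0`.
  have hsplit : f' / g - f = (f' / g) * (1 - g) + (f' - f) := by
    rcases hg0.eq_or_lt with h0 | h0
    · have : f' = 0 := le_antisymm (h0 ▸ hgf) hf0
      rw [this]; ring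
    · field_simp; ring
  rw [hsplit]
  calc |(f' / g) * (1 - g) + (f' - f)| ≤ |f' / g| * |1 - g| + |f' - f| :=
        (abs_add_le _ _).trans (by rw [abs_mul])
    _ ≤ 1 * (M.kappa * r * C) + M.kappa ^ 2 * r := by
        gcongr
        rw [abs_sub_comm]; exact hgg
    _ = _ := by ring

end Augmentation

/-! ### Claim 2: traces on the empirical eigenfunctions. -/

namespace Augmentation

variable {𝒳 𝒜 : Type*} [MeasurableSpace 𝒳] [MeasurableSpace 𝒜] {M : Augmentation 𝒳 𝒜} {N : ℕ}
  {x : Fin N → 𝒳}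

theorem measurable_empGam (f : 𝒳 → ℝ) : Measurable (M.empGam x f) := by
  have hp : ∀ k, Measurable fun a => (M.p (x k) a : ℝ) := fun k =>
    (M.measurable_p_right (x k)).coe_nnreal_real
  have hq : Measurable fun a => (M.empDensity x a : ℝ) := by
    refine Measurable.coe_nnreal_real ?_
    exact measurable_const.mul (Finset.measurable_sum _ fun k _ => M.measurable_p_right (x k))
  exact measurable_const.mul (Finset.measurable_sum _ fun k _ => ((hp k).const_mul _).div hq)

/-- The weights of the average sum to `1`, or to `0` where the empirical density vanishes, so the
bound holds at every `a`. -/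
theorem abs_empGam_le {f : 𝒳 → ℝ} {c : ℝ} (hc : 0 ≤ c) (hf : ∀ k, |f (x k)| ≤ c) (a : 𝒜) :
    |M.empGam x f a| ≤ c := by
  have hq : (M.empDensity x a : ℝ) = (N : ℝ)⁻¹ * ∑ k, (M.p (x k) a : ℝ) := by
    simp [empDensity]
  calc |M.empGam x f a|
      ≤ (N : ℝ)⁻¹ * ∑ k, c * (M.p (x k) a : ℝ) / (M.empDensity x a : ℝ) := by
        rw [empGam, abs_mul, abs_of_nonneg (by positivity : (0 : ℝ) ≤ (N : ℝ)⁻¹)]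
        gcongr
        refine (Finset.abs_sum_le_sum_abs _ _).trans (Finset.sum_le_sum fun k _ => ?_)
        rw [abs_div, abs_mul, NNReal.abs_eq, NNReal.abs_eq]
        gcongr
        exact hf k
    _ = c * ((M.empDensity x a : ℝ) / (M.empDensity x a : ℝ)) := by
        rw [← Finset.sum_div, ← Finset.mul_sum]
        nth_rewrite 2 [hq]
        ring
    _ ≤ c * 1 := by
        gcongr
        exact div_self_le_one _
    _ = c := mul_one c

theorem empGam_sum {ι : Type*} (s : Finset ι) (c : ι → ℝ) (g : ι → 𝒳 → ℝ) {f : 𝒳 → ℝ}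
    (hf : ∀ k, f (x k) = ∑ i ∈ s, c i * g i (x k)) (a : 𝒜) :
    M.empGam x f a = ∑ i ∈ s, c i * M.empGam x (g i) a := by
  simp only [empGam, hf, Finset.mul_sum, Finset.sum_mul, Finset.sum_div]
  rw [Finset.sum_comm]
  refine Finset.sum_congr rfl fun i _ => Finset.sum_congr rfl fun k _ => ?_
  ring

/-- Linear combinations of empirical eigenfunctions are bounded. -/
theorem GoodSample.ae_abs_sum_le (hκ : M.kappaSq ≠ ∞) {r : ℝ} (h : M.GoodSample x r) {d : ℕ}
    {φ : Fin d → 𝒜 → ℝ} {Λ : Fin d → ℝ} (hφ : ∀ i, MemLp (φ i) 2 M.PA) (hΛ : ∀ i, Λ i ≠ 0)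
    (he : ∀ i, M.empGam x (M.GamStar (φ i)) =ᵐ[M.PA] fun a => Λ i * φ i a) (c : Fin d → ℝ) :
    ∀ᵐ a ∂M.PA, |∑ i, c i * φ i a| ≤
      M.kappa * Real.sqrt ((fun i => c i / Λ i) ⬝ᵥ (M.G φ).mulVec fun i => c i / Λ i) := by
  have hw : MemLp (fun a => ∑ i, c i / Λ i * φ i a) 2 M.PA :=
    memLp_finsetSum _ fun i _ => (hφ i).const_mul _
  filter_upwards [ae_all_iff.2 he] with a ha
  -- Dividing the coefficients by the eigenvalues exhibits the combination as `Γ̄Γ*w`.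
  have h1 : ∑ i, c i * φ i a = M.empGam x (M.GamStar fun a => ∑ i, c i / Λ i * φ i a) a := by
    rw [empGam_sum Finset.univ (fun i => c i / Λ i) (fun i => M.GamStar (φ i)) fun k =>
      Regular.GamStar_linear hκ (h.regular k) Finset.univ _ hφ]
    refine Finset.sum_congr rfl fun i _ => ?_
    rw [ha i]
    have := hΛ i
    field_simp
  rw [h1, G, ← integral_sum_sq hφ]
  exact abs_empGam_le (mul_nonneg M.kappa_nonneg (Real.sqrt_nonneg _))
    (fun k => Regular.abs_GamStar_le hκ (h.regular k) hw) a

variable [MeasurableSingletonClass 𝒳] [NeZero N]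

/-- On a good sample, the traces of the population and the empirical Rayleigh quotients on the top
empirical eigenfunctions are close. -/
theorem GoodSample.abs_trace_sub_le (hκ : M.kappaSq ≠ ∞) {r : ℝ} (hr : 0 ≤ r)
    (h : M.GoodSample x r) {d : ℕ} {φ : Fin d → 𝒜 → ℝ} (hφ : M.IsTopEmpEigenfunctions x φ)
    (hpos : 0 < M.empEig x (d - 1)) :
    (∀ i, MemLp (φ i) 2 M.PA) ∧ IsUnit (M.G φ).det ∧ M.empG x φ = 1 ∧
      |((M.empG x φ)⁻¹ * M.empF x φ).trace - ((M.G φ)⁻¹ * M.F φ).trace| ≤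
        d * (r * (M.kappa * (M.empEig x (d - 1))⁻¹ * Real.sqrt (condNumber (M.G φ)) * M.kappa
          + M.kappa ^ 2)) := by
  obtain ⟨⟨hLe, hG1, -⟩, hae⟩ := hφ
  set lam := M.empEig x (d - 1) with hlam
  have hΛle : ∀ i : Fin d, lam ≤ M.empEig x i := fun i => by
    rw [hlam, ← emp_eig]
    exact (M.emp x).eig_antitone (by omega)
  have hΛpos : ∀ i : Fin d, 0 < M.empEig x i := fun i => hpos.trans_le (hΛle i)
  have hκ0 := M.kappa_nonneg
  -- `φ i` equals `λ̄ᵢ⁻¹ Γ̄Γ*φ i` almost everywhere for `PA`, and `Γ̄` of any function is bounded,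
  -- as it sees finitely many values.
  have hφL : ∀ i, MemLp (φ i) 2 M.PA := by
    intro i
    let c := ∑ k, |M.GamStar (φ i) (x k)|
    have hb : MemLp (M.empGam x (M.GamStar (φ i))) 2 M.PA :=
      MemLp.of_bound (measurable_empGam _).aestronglyMeasurable c
        (Filter.Eventually.of_forall fun a => abs_empGam_le
          (Finset.sum_nonneg fun k _ => abs_nonneg _) (fun k => Finset.single_le_sum
            (f := fun k => |M.GamStar (φ i) (x k)|) (fun k _ => abs_nonneg _)
            (Finset.mem_univ k)) a)
    refine (hb.const_mul (M.empEig x i)⁻¹).ae_eq ?_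
    filter_upwards [hae i] with a ha
    rw [ha, inv_mul_cancel_left₀ (hΛpos i).ne']
  have hbound := h.ae_abs_sum_le hκ hφL (fun i => (hΛpos i).ne') hae
  simp only [← emp_PA] at hLe hG1
  obtain ⟨b, D, hb, hGb, hspec, hdet, htr, hquad, hnorm⟩ :=
    (gramL2_isHermitian M.PA φ).exists_diagonalization
  change ∀ i, (M.G φ).mulVec (b i) = D i • b i at hGb
  change spectrum ℝ (M.G φ) = Set.range D at hspec
  change (M.G φ).det = ∏ i, D i at hdet
  change ∀ v, v ⬝ᵥ (M.G φ).mulVec v = ∑ i, D i * (b i ⬝ᵥ v) ^ 2 at hquad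
  have hD : ∀ i, D i = ∫ a, (∑ j, b i j * φ j a) ^ 2 ∂M.PA := fun i => by
    rw [integral_sum_sq hφL]
    change _ = b i ⬝ᵥ (M.G φ).mulVec (b i)
    rw [hGb, dotProduct_smul, hb, if_pos rfl, smul_eq_mul, mul_one]
  have hvL : ∀ c : Fin d → ℝ, MemLp (fun a => ∑ j, c j * φ j a) 2 M.PA := fun c =>
    memLp_finsetSum _ fun i _ => (hφL i).const_mul _
  -- A combination vanishing `PA`-almost everywhere vanishes for the empirical law as well, against
  -- orthonormality there.
  have hDpos : ∀ i, 0 < D i := by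
    intro i
    have h0 : 0 ≤ D i := by rw [hD]; exact integral_nonneg fun a => sq_nonneg _
    refine h0.lt_of_ne fun hz => ?_
    rw [hD, eq_comm, integral_eq_zero_iff_of_nonneg (fun a => sq_nonneg _)
      (hvL (b i)).integrable_sq] at hz
    have hz' : (fun a => (∑ j, b i j * φ j a) ^ 2) =ᵐ[(M.emp x).PA] 0 :=
      (h.emp_PA_absolutelyContinuous hκ).ae_le hz
    have := integral_sum_sq hLe (b i)
    rw [integral_congr_ae hz', hG1, Matrix.one_mulVec, hb, if_pos rfl] at this
    simp at this
  have hunit : IsUnit (M.G φ).det := by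
    rw [hdet]
    exact (Finset.prod_ne_zero_iff.2 fun i _ => (hDpos i).ne').isUnit
  have hempG : M.empG x φ = 1 := by rw [empG, ← emp_PA]; exact hG1
  refine ⟨hφL, hunit, hempG, ?_⟩
  have hGinv : ∀ i v, b i ⬝ᵥ ((M.G φ)⁻¹).mulVec v = (D i)⁻¹ * (b i ⬝ᵥ v) := by
    intro i v
    have hsymm : (M.G φ).transpose = M.G φ := gramL2_isHermitian M.PA φ
    have h1 : b i = D i • Matrix.vecMul (b i) (M.G φ)⁻¹ := by
      rw [← Matrix.smul_vecMul, ← hGb, ← Matrix.vecMul_transpose, hsymm, Matrix.vecMul_vecMul,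
        Matrix.mul_nonsing_inv _ hunit, Matrix.vecMul_one]
    rw [Matrix.dotProduct_mulVec]
    conv_rhs => rw [h1, smul_dotProduct, smul_eq_mul, inv_mul_cancel_left₀ (hDpos i).ne']
  have hfin : (Set.range D).Finite := Set.finite_range D
  have hsup : ∀ i, D i ≤ sSup (Set.range D) := fun i => le_csSup hfin.bddAbove ⟨i, rfl⟩
  have hinf : ∀ i, sInf (Set.range D) ≤ D i := fun i => csInf_le hfin.bddBelow ⟨i, rfl⟩
  rw [hempG, inv_one, Matrix.one_mul, htr, htr, ← Finset.sum_sub_distrib]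
  refine (Finset.abs_sum_le_sum_abs _ _).trans ?_
  calc _ ≤ ∑ _i : Fin d, r * (M.kappa * lam⁻¹ * Real.sqrt (condNumber (M.G φ)) * M.kappa
        + M.kappa ^ 2) := Finset.sum_le_sum fun i _ => ?_
    _ = _ := by simp
  rw [← Matrix.mulVec_mulVec, hGinv]
  have hinfpos : 0 < sInf (Set.range D) := by
    obtain ⟨j, hj⟩ := Set.Nonempty.csInf_mem (⟨_, i, rfl⟩ : (Set.range D).Nonempty) hfin
    rw [← hj]; exact hDpos j
  -- Normalizes the `i`-th rotated eigenfunction in `L²(PA)`; its squared empirical norm becomes `(D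
  -- i)⁻¹`.
  set t := (Real.sqrt (D i))⁻¹ with ht
  have ht2 : t ^ 2 = (D i)⁻¹ := by rw [ht, inv_pow, Real.sq_sqrt (hDpos i).le]
  have hscale : ∀ A : Matrix (Fin d) (Fin d) ℝ,
      (t • b i) ⬝ᵥ A.mulVec (t • b i) = (D i)⁻¹ * (b i ⬝ᵥ A.mulVec (b i)) := fun A => by
    rw [Matrix.mulVec_smul, smul_dotProduct, dotProduct_smul, ← ht2]
    simp only [smul_eq_mul]; ring
  have hupper : ∀ᵐ a ∂M.PA, |∑ j, (t • b i) j * φ j a|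
      ≤ M.kappa * lam⁻¹ * Real.sqrt (condNumber (M.G φ)) := by
    filter_upwards [hbound (t • b i)] with a ha
    refine ha.trans ?_
    rw [mul_assoc]
    gcongr
    rw [← Real.sqrt_sq (inv_nonneg.2 hpos.le), ← Real.sqrt_mul (sq_nonneg _)]
    refine Real.sqrt_le_sqrt ?_
    rw [hquad]
    set v : Fin d → ℝ := fun j => (t • b i) j / M.empEig x j with hv
    -- With `v` the coefficients of `w`: `‖w‖² ≤ λ_max(G)|v|²`, `|v|² ≤ λ̄_d⁻² (D i)⁻¹` and `D i ≥
    -- λ_min(G)`, whence the factor `γ_G^{1/2}` in `C`.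
    calc ∑ j, D j * (b j ⬝ᵥ v) ^ 2 ≤ ∑ j, sSup (Set.range D) * (b j ⬝ᵥ v) ^ 2 := by
          gcongr with j; exact hsup j
      _ = sSup (Set.range D) * (v ⬝ᵥ v) := by rw [hnorm v, Finset.mul_sum]
      _ ≤ sSup (Set.range D) * (lam⁻¹ ^ 2 * (D i)⁻¹) := by
          have hS0 : 0 ≤ sSup (Set.range D) := (hDpos i).le.trans (hsup i)
          gcongr
          have hbi : (t • b i) ⬝ᵥ (t • b i) = (D i)⁻¹ := by
            have := hscale 1
            rwa [Matrix.one_mulVec, Matrix.one_mulVec, hb, if_pos rfl, mul_one] at this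
          rw [← hbi]
          simp only [dotProduct, Finset.mul_sum]
          refine Finset.sum_le_sum fun j _ => ?_
          have : v j * v j = (M.empEig x j)⁻¹ ^ 2 * ((t • b i) j * (t • b i) j) := by
            rw [hv]; simp only; ring
          rw [this]
          have h2 : (M.empEig x j)⁻¹ ≤ lam⁻¹ := inv_anti₀ hpos (hΛle j)
          have h3 : 0 ≤ (M.empEig x j)⁻¹ := inv_nonneg.2 (hΛpos j).le
          exact mul_le_mul_of_nonneg_right (pow_le_pow_left₀ h3 h2 2) (mul_self_nonneg _)
      _ ≤ sSup (Set.range D) * (lam⁻¹ ^ 2 * (sInf (Set.range D))⁻¹) := by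
          have hS0 : 0 ≤ sSup (Set.range D) := (hDpos i).le.trans (hsup i)
          gcongr
          exact hinf i
      _ = lam⁻¹ ^ 2 * condNumber (M.G φ) := by
          rw [condNumber, hspec]; ring
  have h1 : ∫ a, (∑ j, (t • b i) j * φ j a) ^ 2 ∂M.PA = 1 := by
    rw [integral_sum_sq hφL, hscale]
    change (D i)⁻¹ * (b i ⬝ᵥ (M.G φ).mulVec (b i)) = 1
    rw [hGb, dotProduct_smul, hb, if_pos rfl, smul_eq_mul, mul_one, inv_mul_cancel₀ (hDpos i).ne']
  have hkey := h.abs_rayleigh_sub_le hκ hr (hvL (t • b i)) h1 (by positivity) hupper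
  rw [h.integral_GamStar_sum_sq_emp hκ hφL, M.integral_GamStar_sum_sq hκ hφL, hscale, hscale,
    integral_sum_sq hLe, hscale, hG1, Matrix.one_mulVec, hb, if_pos rfl, mul_one,
    mul_div_assoc, mul_comm (D i)⁻¹, div_mul_cancel₀ _ (inv_ne_zero (hDpos i).ne')] at hkey
  exact hkey

/-! ### Claim 1: lower bound for the empirical eigenvalues. -/

/-- On a good sample, the sum of the top empirical eigenvalues is nearly at least the sum of the top
population eigenvalues. -/
theorem GoodSample.sum_eig_sub_le (hκ : M.kappaSq ≠ ∞) {r : ℝ} (hr : 0 ≤ r)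
    (h : M.GoodSample x r) {d : ℕ} {ε : ℝ} (hε : 0 < ε) (hlam : ε < M.eig (d - 1)) :
    ∑ i ∈ Finset.range d, (M.eig i - ε)
        - d * (r * (M.kappa * (M.eig (d - 1) - ε)⁻¹ * M.kappa + M.kappa ^ 2))
      ≤ ∑ j ∈ Finset.range d, M.empEig x j := by
  have hκ0 := M.kappa_nonneg
  set σ := M.eig (d - 1) - ε with hσ
  have hσ0 : 0 < σ := sub_pos.2 hlam
  -- Compactness is not invoked, so the suprema are approached only up to `ε`.
  obtain ⟨s, e, heo, hes, hsε⟩ := exists_orthonormal_eigenvectors M.GamSqL_isSymmetric hε d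
    fun i hi => nonempty_eigSet_of_pos (T := M.GamSqL) (by
      rw [← eig_eq]
      exact (hε.trans hlam).trans_le (M.eig_antitone (by omega)))
  simp only [← eig_eq] at hsε
  have hsσ : ∀ i, σ ≤ s i := fun i => by
    have : M.eig (d - 1) ≤ M.eig i := M.eig_antitone (by omega)
    linarith [hsε i]
  have hs0 : ∀ i, 0 < s i := fun i => hσ0.trans_le (hsσ i)
  -- The dual singular functions: orthonormal in `L²(PA)` and eigenvectors of `ΓΓ*` for the same `s
  -- i`.
  let ψ : Fin d → Lp ℝ 2 M.PA := fun i => (Real.sqrt (s i))⁻¹ • M.GamL (e i)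
  have hψinner : ∀ i j, inner ℝ (ψ i) (ψ j) = if i = j then (1 : ℝ) else 0 := by
    intro i j
    simp only [ψ, real_inner_smul_left, real_inner_smul_right]
    rw [inner_GamL, ← GamSqL_apply, hes, real_inner_smul_right, orthonormal_iff_ite.1 heo]
    split_ifs with hij
    · subst hij
      have := Real.mul_self_sqrt (hs0 i).le
      have h0 := (Real.sqrt_pos.2 (hs0 i)).ne'
      field_simp
      nlinarith
    · ring
  have hψeig : ∀ i, M.GamStarL (ψ i) = Real.sqrt (s i) • e i := by
    intro i
    simp only [ψ, map_smul]
    rw [← GamSqL_apply, hes, smul_smul]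
    congr 1
    have h0 := (Real.sqrt_pos.2 (hs0 i)).ne'
    field_simp
    exact (Real.sq_sqrt (hs0 i).le).symm
  have hψΓ : ∀ i, M.GamL (M.GamStarL (ψ i)) = s i • ψ i := by
    intro i
    rw [hψeig, map_smul]
    simp only [ψ, smul_smul]
    congr 1
    have h0 := (Real.sqrt_pos.2 (hs0 i)).ne'
    field_simp
    exact Real.sq_sqrt (hs0 i).le
  have hψo : Orthonormal ℝ ψ := orthonormal_iff_ite.2 hψinner
  have hcoe : ∀ c : Fin d → ℝ, ⇑(∑ i, c i • ψ i) =ᵐ[M.PA] fun a => ∑ i, c i * ψ i a := by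
    intro c
    have h2 : ∀ i, ⇑(c i • ψ i) =ᵐ[M.PA] fun a => c i * ψ i a := fun i => Lp.coeFn_smul _ _
    filter_upwards [Lp.coeFn_finsetSum Finset.univ fun i => c i • ψ i, ae_all_iff.2 h2]
      with a ha1 ha2
    rw [ha1, Finset.sum_apply]
    exact Finset.sum_congr rfl fun i _ => ha2 i
  have hbound : ∀ c : Fin d → ℝ, c ⬝ᵥ c = 1 →
      ∀ᵐ a ∂M.PA, |∑ i, c i * ψ i a| ≤ M.kappa * σ⁻¹ := by
    intro c hc
    let w : Lp ℝ 2 M.PA := ∑ i, (c i / s i) • ψ i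
    have hw : M.GamL (M.GamStarL w) = ∑ i, c i • ψ i := by
      simp only [w, map_sum, map_smul, hψΓ, smul_smul]
      refine Finset.sum_congr rfl fun i _ => ?_
      rw [div_mul_cancel₀ _ (hs0 i).ne']
    have hwn : ‖w‖ ≤ σ⁻¹ := by
      refine le_of_sq_le_sq ?_ (inv_nonneg.2 hσ0.le)
      rw [← real_inner_self_eq_norm_sq, hψo.inner_sum]
      calc ∑ i, (starRingEnd ℝ) (c i / s i) * (c i / s i) ≤ ∑ i, σ⁻¹ ^ 2 * (c i * c i) := by
            refine Finset.sum_le_sum fun i _ => ?_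
            have h3 : (s i)⁻¹ ≤ σ⁻¹ := inv_anti₀ hσ0 (hsσ i)
            have h4 : (starRingEnd ℝ) (c i / s i) * (c i / s i) = (s i)⁻¹ ^ 2 * (c i * c i) := by
              simp only [conj_trivial]; ring
            rw [h4]
            exact mul_le_mul_of_nonneg_right
              (pow_le_pow_left₀ (inv_nonneg.2 (hs0 i).le) h3 2) (mul_self_nonneg _)
        _ = σ⁻¹ ^ 2 := by
            rw [← Finset.mul_sum]
            change σ⁻¹ ^ 2 * (c ⬝ᵥ c) = _
            rw [hc, mul_one]
    have h5 := M.ae_abs_GamL_GamStarL_le hκ w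
    rw [hw] at h5
    filter_upwards [h5, hcoe c] with a h6 h7
    rw [← h7]
    exact h6.trans (by gcongr)
  have hψL : ∀ i, MemLp (ψ i) 2 M.PA := fun i => Lp.memLp _
  have hvL : ∀ c : Fin d → ℝ, MemLp (fun a => ∑ j, c j * ψ j a) 2 M.PA := fun c =>
    memLp_finsetSum _ fun i _ => (hψL i).const_mul _
  have hψLe : ∀ i, MemLp (ψ i) 2 (M.emp x).PA := fun i => by
    refine h.memLp_emp_PA hκ (hψL i).1 (C := M.kappa * σ⁻¹) ?_
    filter_upwards [hbound (Pi.single i 1) (by simp)] with a ha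
    simpa [Pi.single_apply] using ha
  have hG1 : gramL2 M.PA (fun i => ⇑(ψ i)) = 1 := by
    rw [gramL2_eq_one_iff hψL]
    simpa only [Lp.toLp_coeFn] using hψo
  -- This rotation keeps the family orthonormal for `PA` and makes it orthogonal for the empirical
  -- law; it preserves the trace of `F`.
  obtain ⟨b, D, hb, hGb, -, -, htr, -, -⟩ :=
    (gramL2_isHermitian (M.emp x).PA fun i => ⇑(ψ i)).exists_diagonalization
  let v : Fin d → 𝒜 → ℝ := fun i a => ∑ j, b i j * ψ j a
  have hvLe : ∀ i, MemLp (v i) 2 (M.emp x).PA := fun i =>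
    memLp_finsetSum _ fun j _ => (hψLe j).const_mul _
  have hvinner : ∀ i j, ∫ a, v i a * v j a ∂(M.emp x).PA = if i = j then D j else 0 := by
    intro i j
    rw [integral_sum_mul_sum hψLe, hGb, dotProduct_smul, hb]
    simp
  have hv1 : ∀ i, ∫ a, v i a ^ 2 ∂M.PA = 1 := fun i => by
    rw [integral_sum_sq hψL, hG1, Matrix.one_mulVec, hb, if_pos rfl]
  have hD : ∀ i, ∫ a, v i a ^ 2 ∂(M.emp x).PA = D i := fun i => by
    have := hvinner i i
    rw [if_pos rfl] at this
    simpa only [pow_two] using this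
  have hD0 : ∀ i, 0 ≤ D i := fun i => by
    rw [← hD]; exact integral_nonneg fun a => sq_nonneg _
  have hkey : ∀ i, |(∫ z, M.GamStar (v i) z ^ 2 ∂(M.emp x).PX) / D i
      - ∫ z, M.GamStar (v i) z ^ 2 ∂M.PX| ≤ r * (M.kappa * σ⁻¹ * M.kappa + M.kappa ^ 2) := by
    intro i
    rw [← hD]
    exact h.abs_rayleigh_sub_le hκ hr (hvL (b i)) (hv1 i) (by positivity)
      (hbound (b i) (by rw [hb, if_pos rfl]))
  have hsumF : ∑ i, ∫ z, M.GamStar (v i) z ^ 2 ∂M.PX = ∑ i, s i := by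
    simp only [v, M.integral_GamStar_sum_sq hκ hψL]
    rw [← htr, Matrix.trace]
    refine Finset.sum_congr rfl fun i _ => ?_
    have h8 : (M.F fun i => ⇑(ψ i)).diag i = ∫ z, M.GamStar (ψ i) z ^ 2 ∂M.PX := by
      simp only [F, gramL2, Matrix.diag_apply, Matrix.of_apply, pow_two]
    rw [h8, M.integral_GamStar_sq_eq (hψL i), Lp.toLp_coeFn, hψeig, norm_smul, heo.1, mul_one,
      Real.norm_eq_abs, sq_abs, Real.sq_sqrt (hs0 i).le]
  have hky : ∑ i, (∫ z, M.GamStar (v i) z ^ 2 ∂(M.emp x).PX) / D i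
      ≤ ∑ j ∈ Finset.range d, M.empEig x j := by
    -- Functions of empirical norm zero are dropped; their quotients are `0` by the convention for
    -- division by zero.
    let u : {i : Fin d // D i ≠ 0} → Lp ℝ 2 (M.emp x).PA := fun i =>
      (Real.sqrt (D i))⁻¹ • (hvLe i).toLp (v i)
    have hu : Orthonormal ℝ u := by
      rw [orthonormal_iff_ite]
      intro i j
      simp only [u, real_inner_smul_left, real_inner_smul_right, inner_toLp_eq, hvinner]
      by_cases hij : i = j
      · subst hij
        rw [if_pos rfl, if_pos rfl]
        have h9 : 0 < D i := (hD0 i).lt_of_ne i.2.symm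
        have := Real.mul_self_sqrt h9.le
        have h0 := (Real.sqrt_pos.2 h9).ne'
        field_simp
        nlinarith
      · rw [if_neg hij, if_neg fun h => hij (Subtype.ext h)]; ring
    have hfd : FiniteDimensional ℝ (Lp ℝ 2 (M.emp x).PX) := finiteDimensional_Lp_empMeasure x
    have hKF := sum_norm_sq_le_sum_sortedEig (A := (M.emp x).GamL.toLinearMap)
      (B := (M.emp x).GamStarL.toLinearMap) (M.emp x).inner_GamL (M.emp x).norm_GamL_le
      (d := d) ((Fintype.card_subtype_le fun i : Fin d => D i ≠ 0).trans_eq (Fintype.card_fin d)) hu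
    have h10 : ∀ i, ‖(M.emp x).GamStarL (u i)‖ ^ 2
        = (∫ z, M.GamStar (v i) z ^ 2 ∂(M.emp x).PX) / D i := by
      intro i
      simp only [u]
      rw [map_smul, norm_smul, mul_pow, ← integral_GamStar_sq_eq, Real.norm_eq_abs, sq_abs, inv_pow,
        Real.sq_sqrt (hD0 i), mul_comm, div_eq_mul_inv]
      rfl
    simp only [ContinuousLinearMap.coe_coe, h10] at hKF
    rw [← emp_eig]
    simp only [eig_eq]
    refine le_trans (le_of_eq ?_) hKF
    rw [← Finset.sum_filter_of_ne (p := fun i => D i ≠ 0) fun i _ hi h0 => hi (by rw [h0, div_zero])]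
    exact Finset.sum_subtype _ (fun i => by simp) _
  have hsum_s : ∑ i ∈ Finset.range d, (M.eig i - ε) ≤ ∑ i, s i := by
    rw [Finset.sum_range]
    exact Finset.sum_le_sum fun i _ => hsε i
  have hfinal : ∑ i, s i - d * (r * (M.kappa * σ⁻¹ * M.kappa + M.kappa ^ 2))
      ≤ ∑ i, (∫ z, M.GamStar (v i) z ^ 2 ∂(M.emp x).PX) / D i := by
    rw [← hsumF]
    have : ∑ i : Fin d, (∫ z, M.GamStar (v i) z ^ 2 ∂M.PX
        - r * (M.kappa * σ⁻¹ * M.kappa + M.kappa ^ 2))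
        ≤ ∑ i, (∫ z, M.GamStar (v i) z ^ 2 ∂(M.emp x).PX) / D i :=
      Finset.sum_le_sum fun i _ => by linarith [(abs_le.1 (hkey i)).1]
    rw [Finset.sum_sub_distrib] at this
    simpa using this
  linarith

/-- Let `ε` decrease to `0`; the bound is continuous there because `λ_d > 0`. -/
theorem GoodSample.sum_eig_le (hκ : M.kappaSq ≠ ∞) {r : ℝ} (hr : 0 ≤ r)
    (h : M.GoodSample x r) {d : ℕ} (hlam : 0 < M.eig (d - 1)) :
    ∑ i ∈ Finset.range d, M.eig i
        - d * (r * (M.kappa * (M.eig (d - 1))⁻¹ * M.kappa + M.kappa ^ 2))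
      ≤ ∑ j ∈ Finset.range d, M.empEig x j := by
  let g : ℝ → ℝ := fun ε => ∑ i ∈ Finset.range d, (M.eig i - ε)
    - d * (r * (M.kappa * (M.eig (d - 1) - ε)⁻¹ * M.kappa + M.kappa ^ 2))
  have hcont : ContinuousAt g 0 := by
    have h1 : ContinuousAt (fun ε : ℝ => (M.eig (d - 1) - ε)⁻¹) 0 :=
      (continuousAt_const.sub continuousAt_id).inv₀ (by simpa using hlam.ne')
    have h2 : ContinuousAt (fun ε : ℝ => ∑ i ∈ Finset.range d, (M.eig i - ε)) 0 := by fun_prop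
    exact h2.sub (continuousAt_const.mul (continuousAt_const.mul
      (((continuousAt_const.mul h1).mul continuousAt_const).add continuousAt_const)))
  have hlim : Filter.Tendsto g (nhdsWithin 0 (Set.Ioi 0)) (nhds (g 0)) :=
    hcont.tendsto.mono_left nhdsWithin_le_nhds
  have hle : g 0 ≤ ∑ j ∈ Finset.range d, M.empEig x j := by
    refine le_of_tendsto hlim ?_
    filter_upwards [Ioo_mem_nhdsGT hlam] with ε hε
    exact h.sum_eig_sub_le hκ hr hε.1 hε.2
  simpa only [g, sub_zero] using hle

end Augmentation

/-! ### Assembly. -/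

theorem lemma4 {𝒳 𝒜 Ω : Type*} [MeasurableSpace 𝒳] [MeasurableSingletonClass 𝒳]
    [MeasurableSpace 𝒜] [MeasurableSpace Ω]
    (M : Augmentation 𝒳 𝒜) (hκ : M.kappaSq ≠ ∞)
    (P : Measure Ω) [IsProbabilityMeasure P]
    (N d : ℕ) (hN : 1 ≤ N) (hd : 1 ≤ d) (hlam : 0 < M.eig (d - 1))
    (X : Fin N → Ω → 𝒳) (hX : ∀ k, Measurable (X k)) (hindep : iIndepFun X P)
    (hlaw : ∀ k, P.map (X k) = M.PX)
    (δ : ℝ) (hδ : 0 < δ) :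
    ∃ E : Set Ω, MeasurableSet E ∧ ENNReal.ofReal (1 - δ) ≤ P E ∧
      ∀ ω ∈ E, ∀ x : Fin N → 𝒳, x = (fun k => X k ω) →
        (∑ j ∈ Finset.range d, M.empEig x j ≥
          ∑ i ∈ Finset.range d, M.eig i -
            (2 + Real.sqrt (2 * Real.log (2 / δ))) *
              (((M.eig (d - 1))⁻¹ + 1) * M.kappa ^ 2 / Real.sqrt N) * d) ∧
        ∀ φ : Fin d → 𝒜 → ℝ, M.IsTopEmpEigenfunctions x φ → 0 < M.empEig x (d - 1) →
          (∀ i, MemLp (φ i) 2 M.PA) ∧ (∀ i, MemLp (M.GamStar (φ i)) 2 M.PX) ∧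
          IsUnit (M.G φ).det ∧ IsUnit (M.empG x φ).det ∧
          ∀ C : ℝ, C = M.kappa * (M.empEig x (d - 1))⁻¹ * Real.sqrt (condNumber (M.G φ)) →
            |((M.empG x φ)⁻¹ * M.empF x φ).trace - ((M.G φ)⁻¹ * M.F φ).trace| ≤
              (2 + Real.sqrt (2 * Real.log (2 / δ))) *
                ((C * M.kappa + M.kappa ^ 2) / Real.sqrt N) * d := by
  -- For `δ ≥ 1` the empty event suffices.
  rcases le_or_gt 1 δ with hδ1 | hδ1
  · exact ⟨∅, MeasurableSet.empty, by rw [ENNReal.ofReal_of_nonpos (by linarith)]; exact bot_le,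
      fun ω hω => hω.elim⟩
  have : NeZero N := ⟨by omega⟩
  obtain ⟨S, hS, hSδ, hSg⟩ := M.exists_goodSample_event hκ hN hδ hδ1.le
  set s := Real.sqrt (2 * Real.log (2 / δ)) with hs
  have hs0 : 0 ≤ s := Real.sqrt_nonneg _
  have hκ0 := M.kappa_nonneg
  have hXm : Measurable fun ω k => X k ω := measurable_pi_lambda _ hX
  have hmap : P.map (fun ω k => X k ω) = Measure.pi fun _ : Fin N => M.PX := by
    rw [(iIndepFun_iff_map_fun_eq_pi_map fun k => (hX k).aemeasurable).1 hindep]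
    simp only [hlaw]
  have hr : 0 ≤ (1 + s) / Real.sqrt N := by positivity
  -- The argument yields the constant `1 + s`; the stated `2 + s` is slack.
  have hrate : ∀ A : ℝ, 0 ≤ A → d * ((1 + s) / Real.sqrt N * A) ≤ (2 + s) * (A / Real.sqrt N) * d := by
    intro A hA
    calc d * ((1 + s) / Real.sqrt N * A) = (1 + s) * (A / Real.sqrt N) * d := by ring
      _ ≤ (2 + s) * (A / Real.sqrt N) * d := by gcongr; norm_num
  refine ⟨(fun ω k => X k ω) ⁻¹' S, hXm hS, ?_, ?_⟩
  · rw [← Measure.map_apply hXm hS, hmap]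
    have h1 := probReal_compl_eq_one_sub (μ := Measure.pi fun _ : Fin N => M.PX) hS
    rw [h1, measureReal_def] at hSδ
    exact ENNReal.ofReal_le_of_le_toReal (by linarith)
  · intro ω hω x hx
    have hg := hSg x (hx ▸ hω)
    refine ⟨?_, fun φ hφ hpos => ?_⟩
    · have h1 := hg.sum_eig_le hκ hr hlam
      have h2 := hrate (((M.eig (d - 1))⁻¹ + 1) * M.kappa ^ 2) (by positivity)
      have h3 : M.kappa * (M.eig (d - 1))⁻¹ * M.kappa + M.kappa ^ 2
          = ((M.eig (d - 1))⁻¹ + 1) * M.kappa ^ 2 := by ring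
      rw [h3] at h1
      linarith
    · obtain ⟨hL, hunit, hempG, htr⟩ := hg.abs_trace_sub_le hκ hr hφ hpos
      refine ⟨hL, fun i => M.memLp_GamStar (hL i), hunit, by rw [hempG]; simp, ?_⟩
      rintro C rfl
      exact htr.trans (hrate _ (by positivity))
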